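/- Let $a\neq b$ be points of the circle $\mathbf T$, let $[a,b]$ and $[b,a]$ be the closed oriented arcs from $a$ to $b$ and from $b$ to $a$, and let $g_1,g_2$ be homeomorphisms of $\mathbf T$ whose fixed-point sets are $[a,b]$ and $[b,a]$ respectively. Then $g_1$ and $g_2$ commute, so that $(m,n)\mapsto g_1^mg_2^n$ is an action of $\mathbf Z^2$ on $\mathbf T$. Let $G$ be the groupoid of germs of this action: its elements are the germs $[g(x),g,x]$ of $g=g_1^mg_2^n$ at $x\in\mathbf T$, with source $x$, range $g(x)$, operations $[x,g,y][y,h,z]=[x,gh,z]$ and $[x,g,y]^{-1}=[y,g^{-1},x]$, and the topology having as a base the sets $\{[g(x),g,x]:x\in U\}$, $U\subset\mathbf T$ open. Write $[x,(m,n),x]$ for the germ of $g_1^mg_2^n$ at $x\in\{a,b\}$, and put $S(m,n)=\{[g_1^mg_2^n(x),g_1^mg_2^n,x]:x\in\mathbf T\}$. Let $C_c(G)$ be the space of finite sums $\sum_i\tilde f_i$, where $f_i\in C_c(U_i)$ for an open Hausdorff subset $U_i\subset G$ and $\tilde f_i$ is its extension by zero to $G$. It is a $*$-algebra for $(f*g)(\gamma)=\sum_{r(\gamma')=s(\gamma)}f(\gamma\gamma')g(\gamma'^{-1})$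 and $f^*(\gamma)=\overline{f(\gamma^{-1})}$. Let $C^*_r(G)$ be its completion for the norm $\|f\|_r=\sup_x\|\pi_x(f)\|$, where $\pi_x(f)\xi=f*\xi$ on $\ell^2(s^{-1}(x))$; equivalently, the norm closure of the image of $C_c(G)$ under $\bigoplus_x\pi_x$ on $\ell^2(G)$. Regard $C(\mathbf T)$ as a subalgebra of $C_c(G)\subset C^*_r(G)$ by extending functions on the unit space $\{[x,\mathrm{id},x]\}\cong\mathbf T$ by zero. Then: 1. $G$ is not Hausdorff. The only points of $\mathbf T$ with non-trivial isotropy group are $a$ and $b$, and for $x\in\{a,b\}$ the map $(m,n)\mapsto[x,(m,n),x]$ is an isomorphism of $\mathbf Z^2$ onto the isotropy group at $x$. Each $S(m,n)$ is an open bisection of $G$. 2. The function $$f=\mathbf 1_{S(0,0)}-\mathbf 1_{S(1,0)}-\mathbf 1_{S(0,1)}+\mathbf 1_{S(1,1)}$$ belongs to $C_c(G)$, hence to $C^*_r(G)$. It vanishes outside the finite set $\{[x,(m,n),x]: x\in\{a,b\},\ m,n\in\{0,1\}\}$, which lies in the isotropy at $a$ and $b$, and for $x\in\{a,b\}$ takes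 the values $1,-1,-1,1$ at $[x,(0,0),x]$, $[x,(1,0),x]$, $[x,(0,1),x]$, $[x,(1,1),x]$ respectively. 3. $f$ commutes with every element of $C(\mathbf T)$ but does not belong to $C(\mathbf T)$ (both in $C_c(G)$ and in $C^*_r(G)$). 4. $C(\mathbf T)$ is an abelian sub-$C^*$-algebra of $C^*_r(G)$ which is not maximal abelian. -/

import Mathlib

open Filter Topology

noncomputable section

namespace GermGroupoid

variable {X Γ : Type*} [TopologicalSpace X] [Group Γ]

/-- Two pairs `(g, x)`, `(h, y)` define the same germ when `x = y` and `g`, `h` act in the same way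
on a neighbourhood of that point. -/
def germSetoid (ρ : Γ →* (X ≃ₜ X)) : Setoid (Γ × X) where
  r p q := p.2 = q.2 ∧ ∀ᶠ y in 𝓝 p.2, ρ p.1 y = ρ q.1 y
  iseqv :=
    { refl := fun _ => ⟨rfl, Eventually.of_forall fun _ => rfl⟩
      symm := fun {p q} h => ⟨h.1.symm, by
        rw [← h.1]; exact h.2.mono fun _ hy => hy.symm⟩
      trans := fun {p q t} h k => ⟨h.1.trans k.1, by
        have k2 := k.2
        rw [← h.1] at k2
        filter_upwards [h.2, k2] with y h1 h2 using h1.trans h2⟩ }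

/-- The set `G` of germs of the homeomorphisms `ρ g`, `g ∈ Γ`, of the space `X`: the arrows of the
groupoid of germs of the action `ρ`. -/
def Germ (ρ : Γ →* (X ≃ₜ X)) : Type _ := Quotient (germSetoid ρ)

variable (ρ : Γ →* (X ≃ₜ X))

/-- The germ `[g(x), g, x]` of `ρ g` at `x`. -/
def germ (g : Γ) (x : X) : Germ ρ := Quotient.mk (germSetoid ρ) (g, x)

variable {ρ}

theorem germ_eq_iff {g h : Γ} {x y : X} :
    germ ρ g x = germ ρ h y ↔ x = y ∧ ∀ᶠ z in 𝓝 x, ρ g z = ρ h z :=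
  Quotient.eq (r := germSetoid ρ)

theorem Germ.ind {p : Germ ρ → Prop} (h : ∀ g x, p (germ ρ g x)) (γ : Germ ρ) : p γ :=
  Quotient.ind (fun q => h q.1 q.2) γ

/-- The source `x` of `[g(x), g, x]`. -/
def src (γ : Germ ρ) : X :=
  Quotient.lift (fun p : Γ × X => p.2) (fun _ _ (h : (germSetoid ρ).r _ _) => h.1) γ

/-- The range `g(x)` of `[g(x), g, x]`. -/
def rng (γ : Germ ρ) : X :=
  Quotient.lift (fun p : Γ × X => ρ p.1 p.2) (fun p q (h : (germSetoid ρ).r p q) => by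
    have := h.2.self_of_nhds
    rw [this, h.1]) γ

@[simp] theorem src_germ (g : Γ) (x : X) : src (germ ρ g x) = x := rfl

@[simp] theorem rng_germ (g : Γ) (x : X) : rng (germ ρ g x) = ρ g x := rfl

theorem germ_comp_congr {g g' h h' : Γ} {z : X} (hg : ∀ᶠ y in 𝓝 (ρ h z), ρ g y = ρ g' y)
    (hh : ∀ᶠ y in 𝓝 z, ρ h y = ρ h' y) : germ ρ (g * h) z = germ ρ (g' * h') z := by
  refine germ_eq_iff.2 ⟨rfl, ?_⟩
  have h1 := (ρ h).continuous.continuousAt.eventually hg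
  filter_upwards [h1, hh] with y h1 h2
  rw [map_mul, map_mul, Homeomorph.mul_apply, Homeomorph.mul_apply, h1, h2]

/-- Some `g ∈ Γ` such that `γ` is a germ of `ρ g`. -/
def rep (γ : Germ ρ) : Γ := (Quotient.out (s := germSetoid ρ) γ).1

theorem germ_rep (γ : Germ ρ) : germ ρ (rep γ) (src γ) = γ := by
  have h : germ ρ (rep γ) (Quotient.out (s := germSetoid ρ) γ).2 = γ := Quotient.out_eq γ
  have h2 : (Quotient.out (s := germSetoid ρ) γ).2 = src γ := by
    conv_rhs => rw [← h]
    rfl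
  rwa [h2] at h

/-- The composition `[x, g, y][y, h, z] = [x, gh, z]` of composable germs; it does not depend on the
representatives, see `comp_germ`. -/
def comp (γ δ : Germ ρ) (_h : src γ = rng δ) : Germ ρ :=
  germ ρ (rep γ * rep δ) (src δ)

theorem comp_germ (g h : Γ) (y z : X) (e : src (germ ρ g y) = rng (germ ρ h z)) :
    comp (germ ρ g y) (germ ρ h z) e = germ ρ (g * h) z := by
  have e' : y = ρ h z := e
  subst e'
  have hg := (germ_eq_iff.1 (germ_rep (germ ρ g (ρ h z)))).2
  have hh := (germ_eq_iff.1 (germ_rep (germ ρ h z))).2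
  simp only [src_germ] at hg hh
  refine germ_comp_congr ?_ hh
  rw [src_germ, hh.self_of_nhds]
  exact hg

/-- The inverse `[x, g, y]⁻¹ = [y, g⁻¹, x]`. -/
def inv (γ : Germ ρ) : Germ ρ :=
  Quotient.lift (fun p : Γ × X => germ ρ p.1⁻¹ (ρ p.1 p.2)) (by
    rintro ⟨g, x⟩ ⟨h, y⟩ ⟨e, hgh⟩
    dsimp only at e hgh
    subst e
    refine germ_eq_iff.2 ⟨hgh.self_of_nhds, ?_⟩
    have h1 : ∀ᶠ z in 𝓝 (ρ g x), ρ g (ρ g⁻¹ z) = ρ h (ρ g⁻¹ z) := by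
      have hc : ContinuousAt (ρ g⁻¹) (ρ g x) := (ρ g⁻¹).continuous.continuousAt
      have e : ρ g⁻¹ (ρ g x) = x := by
        rw [← Homeomorph.mul_apply, ← map_mul]; simp
      rw [ContinuousAt, e] at hc
      exact hc.eventually hgh
    filter_upwards [h1] with z hz
    have hz' : z = ρ h (ρ g⁻¹ z) := by
      rw [← hz, ← Homeomorph.mul_apply, ← map_mul]; simp
    conv_rhs => rw [hz']
    rw [← Homeomorph.mul_apply (ρ h⁻¹), ← map_mul]; simp) γ

@[simp] theorem inv_germ (g : Γ) (x : X) : inv (germ ρ g x) = germ ρ g⁻¹ (ρ g x) := rfl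

@[simp] theorem map_inv_apply_self (g : Γ) (x : X) : ρ g⁻¹ (ρ g x) = x := by
  rw [← Homeomorph.mul_apply, ← map_mul]; simp

@[simp] theorem map_apply_inv_self (g : Γ) (x : X) : ρ g (ρ g⁻¹ x) = x := by
  rw [← Homeomorph.mul_apply, ← map_mul]; simp

theorem map_mul_apply (g h : Γ) (x : X) : ρ (g * h) x = ρ g (ρ h x) := by
  rw [map_mul, Homeomorph.mul_apply]

@[simp] theorem src_inv (γ : Germ ρ) : src (inv γ) = rng γ := by
  induction γ using Germ.ind with | h g x => rfl

@[simp] theorem rng_inv (γ : Germ ρ) : rng (inv γ) = src γ := by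
  induction γ using Germ.ind with | h g x => simp

@[simp] theorem inv_inv' (γ : Germ ρ) : inv (inv γ) = γ := by
  induction γ using Germ.ind with | h g x => simp

@[simp] theorem src_comp (γ δ : Germ ρ) (e) : src (comp γ δ e) = src δ := rfl

@[simp] theorem rng_comp (γ δ : Germ ρ) (e) : rng (comp γ δ e) = rng γ := by
  induction γ using Germ.ind with | h g y => ?_
  induction δ using Germ.ind with | h h z => ?_
  have e' : y = ρ h z := e
  rw [comp_germ, rng_germ, rng_germ, map_mul_apply, e']

variable (ρ) in
/-- The unit `[x, id, x]` at `x`; the unit space of `G` is identified with `X` in this way. -/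
def unit (x : X) : Germ ρ := germ ρ 1 x

theorem comp_assoc (α β γ : Germ ρ) (h : src α = rng β) (k : src β = rng γ) :
    comp (comp α β h) γ (by rw [src_comp, k]) = comp α (comp β γ k) (by rw [rng_comp, h]) := by
  induction α using Germ.ind with | h g y => ?_
  induction β using Germ.ind with | h h z => ?_
  induction γ using Germ.ind with | h k w => ?_
  simp only [comp_germ, mul_assoc]

theorem unit_comp (γ : Germ ρ) {x : X} (h : x = rng γ) : comp (unit ρ x) γ h = γ := by
  induction γ using Germ.ind with | h g y => ?_
  simp only [unit, comp_germ, one_mul]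

theorem comp_unit (γ : Germ ρ) {x : X} (h : src γ = x) :
    comp γ (unit ρ x) (by simp [unit, h]) = γ := by
  subst h
  induction γ using Germ.ind with | h g y => ?_
  simp only [unit, src_germ, comp_germ, mul_one]

theorem inv_comp (γ : Germ ρ) : comp (inv γ) γ (src_inv γ) = unit ρ (src γ) := by
  induction γ using Germ.ind with | h g y => ?_
  simp only [unit, src_germ, inv_germ, comp_germ, inv_mul_cancel]

theorem comp_inv (γ : Germ ρ) : comp γ (inv γ) (rng_inv γ).symm = unit ρ (rng γ) := by
  induction γ using Germ.ind with | h g y => ?_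
  simp only [unit, inv_germ, comp_germ, mul_inv_cancel, rng_germ]

variable (ρ) in
/-- The isotropy group of `G` at `x`: the germs with source and range `x`. -/
def Isotropy (x : X) : Type _ := {γ : Germ ρ // src γ = x ∧ rng γ = x}

instance (x : X) : Group (Isotropy ρ x) where
  mul γ δ := ⟨comp γ.1 δ.1 (γ.2.1.trans δ.2.2.symm), δ.2.1, by rw [rng_comp]; exact γ.2.2⟩
  one := ⟨unit ρ x, rfl, by simp [unit]⟩
  inv γ := ⟨inv γ.1, by rw [src_inv]; exact γ.2.2, by rw [rng_inv]; exact γ.2.1⟩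
  mul_assoc α β γ := Subtype.ext (comp_assoc α.1 β.1 γ.1 (α.2.1.trans β.2.2.symm) (β.2.1.trans γ.2.2.symm))
  one_mul γ := Subtype.ext (unit_comp γ.1 γ.2.2.symm)
  mul_one γ := Subtype.ext (comp_unit γ.1 γ.2.1)
  inv_mul_cancel γ := Subtype.ext ((inv_comp γ.1).trans (congrArg (unit ρ) γ.2.1))

/-! ### Topology -/

variable (ρ) in
/-- The set of the germs of `ρ g` at the points of `U`. -/
def germsOn (g : Γ) (U : Set X) : Set (Germ ρ) := germ ρ g '' U

/-- The topology of germs, with the sets `germsOn ρ g U`, `U` open, as a base. -/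
instance : TopologicalSpace (Germ ρ) :=
  TopologicalSpace.generateFrom {W | ∃ (g : Γ) (U : Set X), IsOpen U ∧ W = germsOn ρ g U}

variable (ρ) in
/-- The bisection `S(g) = {[g(x), g, x] : x ∈ X}`. -/
def bisection (g : Γ) : Set (Germ ρ) := germsOn ρ g Set.univ

/-- An open bisection: an open set of germs on which the source map and the range map restrict to
homeomorphisms onto open subsets of the unit space. -/
def IsOpenBisection (S : Set (Germ ρ)) : Prop :=
  IsOpen S ∧ IsOpenEmbedding (S.domRestrict src) ∧ IsOpenEmbedding (S.domRestrict rng)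

theorem mem_bisection {g : Γ} {γ : Germ ρ} : γ ∈ bisection ρ g ↔ γ = germ ρ g (src γ) := by
  constructor
  · rintro ⟨x, -, rfl⟩; rfl
  · intro h; rw [h]; exact ⟨_, trivial, rfl⟩

theorem isOpen_germsOn (g : Γ) {U : Set X} (hU : IsOpen U) : IsOpen (germsOn ρ g U) :=
  TopologicalSpace.isOpen_generateFrom_of_mem ⟨g, U, hU, rfl⟩

theorem continuous_germ (g : Γ) : Continuous (germ ρ g) := by
  refine continuous_generateFrom_iff.2 ?_
  rintro _ ⟨h, U, hU, rfl⟩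
  have : germ ρ g ⁻¹' germsOn ρ h U = U ∩ {x | ∀ᶠ z in 𝓝 x, ρ h z = ρ g z} := by
    ext x
    simp only [Set.mem_preimage, Set.mem_inter_iff, Set.mem_ofPred_eq]
    constructor
    · rintro ⟨y, hy, e⟩
      obtain ⟨rfl, e2⟩ := germ_eq_iff.1 e
      exact ⟨hy, e2⟩
    · rintro ⟨hx, e⟩
      exact ⟨x, hx, germ_eq_iff.2 ⟨rfl, e⟩⟩
  rw [this]
  exact hU.inter isOpen_setOfPred_eventually_nhds

theorem continuous_src : Continuous (src : Germ ρ → X) := by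
  refine ⟨fun U hU => ?_⟩
  have : (src : Germ ρ → X) ⁻¹' U = ⋃ g, germsOn ρ g U := by
    ext γ
    induction γ using Germ.ind with | h g x => ?_
    simp only [Set.mem_preimage, src_germ, Set.mem_iUnion]
    constructor
    · exact fun hx => ⟨g, x, hx, rfl⟩
    · rintro ⟨h, y, hy, e⟩
      rw [← (germ_eq_iff.1 e).1]; exact hy
  rw [this]
  exact isOpen_iUnion fun g => isOpen_germsOn g hU

instance [LocallyCompactSpace X] : LocallyCompactSpace (Germ ρ) where
  local_compact_nhds := by
    intro γ n hn
    induction γ using Germ.ind with | h g x => ?_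
    have h1 : germ ρ g ⁻¹' n ∈ 𝓝 x := (continuous_germ g).continuousAt.preimage_mem_nhds hn
    obtain ⟨K, hK, hKn, hKc⟩ := local_compact_nhds h1
    refine ⟨germ ρ g '' K, ?_, ?_, hKc.image (continuous_germ g)⟩
    · obtain ⟨U, hUK, hU, hx⟩ := mem_nhds_iff.1 hK
      exact mem_of_superset ((isOpen_germsOn g hU).mem_nhds ⟨x, hx, rfl⟩)
        (Set.image_mono hUK)
    · exact Set.image_subset_iff.2 hKn

/-! ### Functions on `G` -/

variable (ρ) in
/-- `C_c(G)` for a groupoid `G` that need not be Hausdorff: the finite sums of functions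
`f : G → ℂ` for which there is an open Hausdorff subset `U` of `G` such that `f` is
continuous on `U` and vanishes outside a compact subset of `U`. -/
def Cc : Submodule ℂ (Germ ρ → ℂ) :=
  Submodule.span ℂ {f | ∃ U : Set (Germ ρ), IsOpen U ∧ T2Space U ∧ ContinuousOn f U ∧
    ∃ K ⊆ U, IsCompact K ∧ ∀ γ ∉ K, f γ = 0}

/-- The convolution `(f * g)(γ) = ∑ f(γ δ) g(δ⁻¹)`, where `δ` runs over the germs with range
the source of `γ`. -/
def conv (f g : Germ ρ → ℂ) (γ : Germ ρ) : ℂ :=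
  ∑' δ : {δ : Germ ρ // rng δ = src γ}, f (comp γ δ.1 δ.2.symm) * g (inv δ.1)

variable (ρ) in
/-- The function on `G` that vanishes off the bisection `S(g)` and whose value at `[g(x), g, x]`
is `φ x`. -/
def bisectionFun (g : Γ) (φ : X → ℂ) : Germ ρ → ℂ :=
  (bisection ρ g).indicator fun γ => φ (src γ)

variable (ρ) in
/-- A function `φ` on the unit space `X`, regarded as a function on `G` vanishing off the units. -/
def unitFun (φ : X → ℂ) : Germ ρ → ℂ :=
  (Set.range (unit ρ)).indicator fun γ => φ (src γ)

theorem unitFun_eq (φ : X → ℂ) : unitFun ρ φ = bisectionFun ρ 1 φ := by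
  unfold unitFun bisectionFun bisection germsOn
  rw [Set.image_univ]; rfl

variable (ρ) in
/-- The Hilbert space `ℓ²(G)`, the direct sum over `x ∈ X` of the spaces `ℓ²(G_x)`, where `G_x` is
the set of the germs with source `x`. -/
abbrev L2 : Type _ := lp (fun _ : Germ ρ => ℂ) 2

/-! ### The functions in `C_c(G)` are sums of functions supported on the bisections `S(g)` -/

@[simp] theorem bisectionFun_germ (g : Γ) (φ : X → ℂ) (x : X) :
    bisectionFun ρ g φ (germ ρ g x) = φ x :=
  Set.indicator_of_mem (mem_bisection.2 rfl) _

theorem isOpen_bisection (g : Γ) : IsOpen (bisection ρ g) := isOpen_germsOn g isOpen_univ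

theorem bisectionFun_mem [T2Space X] [CompactSpace X] (g : Γ) (φ : C(X, ℂ)) :
    bisectionFun ρ g φ ∈ Cc ρ := by
  refine Submodule.subset_span ⟨bisection ρ g, isOpen_bisection g, ?_, ?_, bisection ρ g,
    subset_rfl, ?_, fun γ hγ => Set.indicator_of_notMem hγ _⟩
  · refine T2Space.of_injective_continuous (f := fun γ : bisection ρ g => src γ.1) ?_
      (continuous_src.comp continuous_subtype_val)
    intro γ δ h
    refine Subtype.ext ?_
    rw [mem_bisection.1 γ.2, mem_bisection.1 δ.2]
    exact congrArg _ h
  · refine ContinuousOn.congr (f := fun γ => φ (src γ))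
      (φ.continuous.comp continuous_src).continuousOn ?_
    exact fun γ hγ => Set.indicator_of_mem hγ _
  · exact isCompact_univ.image (continuous_germ g)

theorem unitFun_mem [T2Space X] [CompactSpace X] (φ : C(X, ℂ)) : unitFun ρ φ ∈ Cc ρ := by
  rw [unitFun_eq]; exact bisectionFun_mem 1 φ

theorem Cc_le_span [T2Space X] [CompactSpace X] :
    Cc ρ ≤ Submodule.span ℂ {f | ∃ (g : Γ) (φ : C(X, ℂ)), f = bisectionFun ρ g φ} := by
  classical
  refine Submodule.span_le.2 ?_
  rintro f ⟨U, hU, hT, hf, K, hKU, hK, hfK⟩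
  obtain ⟨t, ht⟩ := hK.elim_finite_subcover (fun g : Γ => bisection ρ g) isOpen_bisection (by
    intro γ _
    exact Set.mem_iUnion.2 ⟨rep γ, mem_bisection.2 (germ_rep γ).symm⟩)
  have : LocallyCompactSpace U := hU.locallyCompactSpace
  let e := t.equivFin.symm
  have hK' : IsCompact ((↑) ⁻¹' K : Set U) := by
    refine Subtype.isCompact_iff.2 ?_
    rwa [Subtype.image_preimage_coe, Set.inter_eq_right.2 hKU]
  obtain ⟨p, hps, hp1, -, hpc⟩ := exists_continuous_sum_one_of_isOpen_isCompact
    (s := fun i => ((↑) ⁻¹' bisection ρ (e i).1 : Set U))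
    (fun i => (isOpen_bisection _).preimage continuous_subtype_val) hK' (by
      intro γ hγ
      have h := ht hγ
      simp only [Set.mem_iUnion] at h ⊢
      obtain ⟨g, hg, h⟩ := h
      exact ⟨t.equivFin ⟨g, hg⟩, by simpa [e] using h⟩)
  let ψ : Fin t.card → X → ℂ := fun i x =>
    if h : germ ρ (e i).1 x ∈ U then f (germ ρ (e i).1 x) * p i ⟨_, h⟩ else 0
  have hψ : ∀ i, Continuous (ψ i) := by
    intro i
    refine continuous_iff_continuousAt.2 fun x => ?_
    by_cases hx : germ ρ (e i).1 x ∈ U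
    · have hV : IsOpen (germ ρ (e i).1 ⁻¹' U) := hU.preimage (continuous_germ _)
      refine ContinuousOn.continuousAt ?_ (hV.mem_nhds hx)
      rw [continuousOn_iff_continuous_domRestrict]
      have : (germ ρ (e i).1 ⁻¹' U).domRestrict (ψ i) = fun y =>
          f (germ ρ (e i).1 y.1) * (p i ⟨germ ρ (e i).1 y.1, y.2⟩ : ℂ) := by
        ext y
        exact dif_pos y.2
      rw [this]
      refine Continuous.mul ?_ ?_
      · exact hf.comp_continuous ((continuous_germ _).comp continuous_subtype_val) fun y => y.2
      · refine Complex.continuous_ofReal.comp ((p i).continuous.comp ?_)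
        exact Continuous.subtype_mk ((continuous_germ _).comp continuous_subtype_val) _
    · let L : Set X := (fun γ : U => src γ.1) '' tsupport (p i)
      have hL : IsClosed L := (IsCompact.image (hpc i)
        (continuous_src.comp continuous_subtype_val)).isClosed
      have hxL : x ∈ Lᶜ := by
        rintro ⟨γ, hγ, rfl⟩
        have := mem_bisection.1 (hps i hγ)
        rw [← this] at hx
        exact hx γ.2
      refine ContinuousAt.congr (f := fun _ => (0 : ℂ)) continuousAt_const ?_
      filter_upwards [hL.isOpen_compl.mem_nhds hxL] with y hy
      by_cases hyU : germ ρ (e i).1 y ∈ U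
      · have : p i ⟨_, hyU⟩ = 0 := by
          by_contra hne
          exact hy ⟨⟨_, hyU⟩, subset_tsupport _ hne, rfl⟩
        simp [ψ, hyU, this]
      · simp [ψ, hyU]
  have key : f = ∑ i, bisectionFun ρ (e i).1 (ψ i) := by
    ext γ
    rw [Finset.sum_apply]
    by_cases hγ : γ ∈ U
    · have h1 : ∀ i, bisectionFun ρ (e i).1 (ψ i) γ = f γ * p i ⟨γ, hγ⟩ := by
        intro i
        by_cases hi : γ ∈ bisection ρ (e i).1
        · have h2 := mem_bisection.1 hi
          have h3 : germ ρ (e i).1 (src γ) ∈ U := by rwa [← h2]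
          unfold bisectionFun
          rw [Set.indicator_of_mem hi]
          simp only [ψ, dif_pos h3]
          have h4 : (⟨_, h3⟩ : U) = ⟨γ, hγ⟩ := Subtype.ext h2.symm
          rw [h4, ← h2]
        · have : p i ⟨γ, hγ⟩ = 0 := by
            by_contra hne
            exact hi (hps i (subset_tsupport _ hne))
          unfold bisectionFun
          rw [Set.indicator_of_notMem hi, this]; simp
      simp only [h1, ← Finset.mul_sum]
      by_cases hk : γ ∈ K
      · have := hp1 (show (⟨γ, hγ⟩ : U) ∈ ((↑) ⁻¹' K : Set U) from hk)
        simp only [Finset.sum_apply, Pi.one_apply] at this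
        rw [← Complex.ofReal_sum, this]; simp
      · rw [hfK γ hk, zero_mul]
    · rw [hfK γ fun h => hγ (hKU h), Finset.sum_eq_zero]
      intro i _
      by_cases hi : γ ∈ bisection ρ (e i).1
      · have h2 := mem_bisection.1 hi
        have h3 : germ ρ (e i).1 (src γ) ∉ U := by rwa [← h2]
        unfold bisectionFun
        rw [Set.indicator_of_mem hi]
        exact dif_neg h3
      · exact Set.indicator_of_notMem hi _
  rw [key]
  exact Submodule.sum_mem _ fun i _ => Submodule.subset_span ⟨_, ⟨ψ i, hψ i⟩, rfl⟩

/-! ### The regular representation -/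

variable (ρ) in
/-- The bijection `γ ↦ [g(r(γ)), g, r(γ)] γ` of `G`. -/
def translate (g : Γ) : Germ ρ ≃ Germ ρ where
  toFun γ := comp (germ ρ g (rng γ)) γ rfl
  invFun γ := comp (germ ρ g⁻¹ (rng γ)) γ rfl
  left_inv γ := by
    induction γ using Germ.ind with | h h x => simp [comp_germ]
  right_inv γ := by
    induction γ using Germ.ind with | h h x => simp [comp_germ]

@[simp] theorem translate_germ (g h : Γ) (x : X) :
    translate ρ g (germ ρ h x) = germ ρ (g * h) x := by
  have e : src (germ ρ g (ρ h x)) = rng (germ ρ h x) := by simp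
  exact comp_germ g h (ρ h x) x e

@[simp] theorem rng_translate (g : Γ) (γ : Germ ρ) : rng (translate ρ g γ) = ρ g (rng γ) := by
  induction γ using Germ.ind with | h h x => simp

theorem eq_of_comp_mem_bisection {g : Γ} {γ δ : Germ ρ} {e : src γ = rng δ}
    (h : comp γ δ e ∈ bisection ρ g) : δ = inv (translate ρ g⁻¹ γ) := by
  induction γ using Germ.ind with | h h x => ?_
  induction δ using Germ.ind with | h k z => ?_
  rw [comp_germ, mem_bisection, src_germ] at h
  have e' : x = ρ k z := e
  subst e'
  have hev := (germ_eq_iff.1 h).2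
  rw [translate_germ, inv_germ]
  refine germ_eq_iff.2 ⟨?_, ?_⟩
  · have := hev.self_of_nhds
    rw [map_mul_apply] at *
    rw [this]; simp
  · filter_upwards [hev] with y hy
    rw [map_mul_apply] at hy
    rw [mul_inv_rev, inv_inv, map_mul_apply, ← hy]; simp

theorem conv_bisectionFun (g : Γ) (φ : X → ℂ) (ξ : Germ ρ → ℂ) (γ : Germ ρ) :
    conv (bisectionFun ρ g φ) ξ γ = φ (ρ g⁻¹ (rng γ)) * ξ (translate ρ g⁻¹ γ) := by
  have hr : rng (inv (translate ρ g⁻¹ γ)) = src γ := by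
    rw [rng_inv]; rfl
  unfold conv
  rw [tsum_eq_single ⟨inv (translate ρ g⁻¹ γ), hr⟩]
  · rw [inv_inv']
    congr 1
    revert hr
    induction γ using Germ.ind with | h h x => ?_
    simp only [translate_germ, inv_germ, mul_inv_rev, inv_inv, comp_germ, mul_inv_cancel_left]
    intro _
    rw [bisectionFun_germ, map_mul_apply]; rfl
  · rintro ⟨δ, hδ⟩ hne
    rw [mul_eq_zero]
    left
    refine Set.indicator_of_notMem (fun hmem => hne ?_) _
    exact Subtype.ext (eq_of_comp_mem_bisection hmem)

theorem Cc_induction [T2Space X] [CompactSpace X] {p : (f : Germ ρ → ℂ) → f ∈ Cc ρ → Prop}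
    (bis : ∀ (g : Γ) (φ : C(X, ℂ)), p (bisectionFun ρ g φ) (bisectionFun_mem g φ))
    (add : ∀ f g hf hg, p f hf → p g hg → p (f + g) (add_mem hf hg))
    (smul : ∀ (c : ℂ) f hf, p f hf → p (c • f) (Submodule.smul_mem _ c hf))
    {f : Germ ρ → ℂ} (hf : f ∈ Cc ρ) : p f hf := by
  have hle : Submodule.span ℂ {f | ∃ (g : Γ) (φ : C(X, ℂ)), f = bisectionFun ρ g φ} ≤ Cc ρ := by
    refine Submodule.span_le.2 ?_
    rintro _ ⟨g, φ, rfl⟩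
    exact bisectionFun_mem g φ
  have main : ∀ f (h : f ∈ Submodule.span ℂ
      {f | ∃ (g : Γ) (φ : C(X, ℂ)), f = bisectionFun ρ g φ}), p f (hle h) := by
    intro f h
    induction h using Submodule.span_induction with
    | mem f h =>
      obtain ⟨g, φ, rfl⟩ := h
      exact bis g φ
    | zero =>
      have := smul 0 _ _ (bis 1 0)
      simpa using this
    | add f g hf hg h1 h2 => exact add _ _ _ _ h1 h2
    | smul c f hf h => exact smul _ _ _ h
  exact main f (Cc_le_span hf)

theorem finite_support_of_mem [T2Space X] [CompactSpace X] {f : Germ ρ → ℂ} (hf : f ∈ Cc ρ)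
    (γ : Germ ρ) :
    (Function.support fun δ : {δ : Germ ρ // rng δ = src γ} =>
      f (comp γ δ.1 δ.2.symm)).Finite := by
  induction hf using Cc_induction with
  | bis g φ =>
    refine Set.Subsingleton.finite fun δ hδ δ' hδ' => Subtype.ext ?_
    rw [eq_of_comp_mem_bisection (Set.mem_of_indicator_ne_zero hδ),
      eq_of_comp_mem_bisection (Set.mem_of_indicator_ne_zero hδ')]
  | add f g hf hg h1 h2 => exact (h1.union h2).subset (Function.support_add _ _)
  | smul c f hf h => exact h.subset (Function.support_const_smul_subset c _)

theorem summable_conv [T2Space X] [CompactSpace X] {f : Germ ρ → ℂ} (hf : f ∈ Cc ρ)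
    (ξ : Germ ρ → ℂ) (γ : Germ ρ) :
    Summable fun δ : {δ : Germ ρ // rng δ = src γ} =>
      f (comp γ δ.1 δ.2.symm) * ξ (inv δ.1) :=
  summable_of_hasFiniteSupport ((finite_support_of_mem hf γ).subset fun _ h h0 => h (by
    simp [h0]))

theorem conv_add_left [T2Space X] [CompactSpace X] {f g : Germ ρ → ℂ} (hf : f ∈ Cc ρ)
    (hg : g ∈ Cc ρ) (ξ : Germ ρ → ℂ) : conv (f + g) ξ = conv f ξ + conv g ξ := by
  ext γ
  simp only [conv, Pi.add_apply, add_mul]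
  exact (summable_conv hf ξ γ).tsum_add (summable_conv hg ξ γ)

theorem conv_smul_left (c : ℂ) (f ξ : Germ ρ → ℂ) : conv (c • f) ξ = c • conv f ξ := by
  ext γ
  simp only [conv, Pi.smul_apply, smul_eq_mul, mul_assoc]
  exact tsum_mul_left

theorem conv_add_right [T2Space X] [CompactSpace X] {f : Germ ρ → ℂ} (hf : f ∈ Cc ρ)
    (ξ η : Germ ρ → ℂ) : conv f (ξ + η) = conv f ξ + conv f η := by
  ext γ
  simp only [conv, Pi.add_apply, mul_add]
  exact (summable_conv hf ξ γ).tsum_add (summable_conv hf η γ)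

theorem conv_smul_right (c : ℂ) (f ξ : Germ ρ → ℂ) : conv f (c • ξ) = c • conv f ξ := by
  ext γ
  simp only [conv, Pi.smul_apply, smul_eq_mul, mul_left_comm _ c]
  exact tsum_mul_left

theorem conv_bisectionFun_bisectionFun (g h : Γ) (φ ψ : X → ℂ) :
    conv (bisectionFun ρ g φ) (bisectionFun ρ h ψ) =
      bisectionFun ρ (g * h) fun x => φ (ρ h x) * ψ x := by
  classical
  ext γ
  rw [conv_bisectionFun]
  have hiff : translate ρ g⁻¹ γ ∈ bisection ρ h ↔ γ ∈ bisection ρ (g * h) := by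
    have hs : src (translate ρ g⁻¹ γ) = src γ := rfl
    rw [mem_bisection, mem_bisection, hs]
    rw [← translate_germ g h, ← (translate ρ g).injective.eq_iff]
    have : translate ρ g (translate ρ g⁻¹ γ) = γ := by
      induction γ using Germ.ind with | h h x => simp
    rw [this]
  by_cases hγ : γ ∈ bisection ρ (g * h)
  · have h1 := mem_bisection.1 hγ
    rw [h1, translate_germ, inv_mul_cancel_left, bisectionFun_germ, bisectionFun_germ, rng_germ,
      ← map_mul_apply, inv_mul_cancel_left]
  · unfold bisectionFun
    rw [Set.indicator_of_notMem hγ, Set.indicator_of_notMem (fun h => hγ (hiff.1 h)), mul_zero]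

theorem conv_mem [T2Space X] [CompactSpace X] {f g : Germ ρ → ℂ} (hf : f ∈ Cc ρ) (hg : g ∈ Cc ρ) :
    conv f g ∈ Cc ρ := by
  induction hf using Cc_induction with
  | bis k φ =>
    induction hg using Cc_induction with
    | bis h ψ =>
      rw [conv_bisectionFun_bisectionFun]
      exact bisectionFun_mem _ ⟨fun x => φ (ρ h x) * ψ x,
        (φ.continuous.comp (ρ h).continuous).mul ψ.continuous⟩
    | add f g hf hg h1 h2 =>
      rw [conv_add_right (bisectionFun_mem k φ)]
      exact add_mem h1 h2
    | smul c f hf h =>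
      rw [conv_smul_right]
      exact Submodule.smul_mem _ c h
  | add f g hf hg h1 h2 =>
    rw [conv_add_left hf hg]
    exact add_mem h1 h2
  | smul c f hf h =>
    rw [conv_smul_left]
    exact Submodule.smul_mem _ c h

theorem conv_assoc [T2Space X] [CompactSpace X] {f g : Germ ρ → ℂ} (hf : f ∈ Cc ρ)
    (hg : g ∈ Cc ρ) (ξ : Germ ρ → ℂ) : conv (conv f g) ξ = conv f (conv g ξ) := by
  induction hf using Cc_induction with
  | bis k φ =>
    induction hg using Cc_induction with
    | bis h ψ =>
      rw [conv_bisectionFun_bisectionFun]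
      ext γ
      rw [conv_bisectionFun, conv_bisectionFun, conv_bisectionFun]
      induction γ using Germ.ind with | h l x => ?_
      simp [mul_assoc]
    | add f g hf hg h1 h2 =>
      rw [conv_add_right (bisectionFun_mem k φ), conv_add_left hf hg, conv_add_left
        (conv_mem (bisectionFun_mem k φ) hf) (conv_mem (bisectionFun_mem k φ) hg), h1, h2,
        conv_add_right (bisectionFun_mem k φ)]
    | smul c f hf h =>
      rw [conv_smul_right, conv_smul_left, h, conv_smul_left, conv_smul_right]
  | add f g' hf hg' h1 h2 =>
    rw [conv_add_left hf hg', conv_add_left (conv_mem hf hg) (conv_mem hg' hg), h1, h2,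
      conv_add_left hf hg']
  | smul c f hf h =>
    rw [conv_smul_left, conv_smul_left, h, conv_smul_left]

/-- The involution `f*(γ) = conj (f(γ⁻¹))`. -/
def adj (f : Germ ρ → ℂ) (γ : Germ ρ) : ℂ := star (f (inv γ))

theorem adj_bisectionFun (g : Γ) (φ : X → ℂ) :
    adj (bisectionFun ρ g φ) = bisectionFun ρ g⁻¹ fun x => star (φ (ρ g⁻¹ x)) := by
  ext γ
  unfold adj
  by_cases hγ : γ ∈ bisection ρ g⁻¹
  · rw [mem_bisection.1 hγ]
    simp
  · unfold bisectionFun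
    rw [Set.indicator_of_notMem hγ, Set.indicator_of_notMem, star_zero]
    intro h
    apply hγ
    have h1 := mem_bisection.1 h
    rw [← inv_inv' γ, h1]
    exact mem_bisection.2 rfl

theorem adj_mem [T2Space X] [CompactSpace X] {f : Germ ρ → ℂ} (hf : f ∈ Cc ρ) : adj f ∈ Cc ρ := by
  induction hf using Cc_induction with
  | bis g φ =>
    rw [adj_bisectionFun]
    exact bisectionFun_mem _ ⟨fun x => star (φ (ρ g⁻¹ x)),
      continuous_star.comp (φ.continuous.comp (ρ g⁻¹).continuous)⟩
  | add f g hf hg h1 h2 =>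
    have : adj (f + g) = adj f + adj g := by ext; simp [adj]
    rw [this]; exact add_mem h1 h2
  | smul c f hf h =>
    have : adj (c • f) = star c • adj f := by ext; simp [adj]
    rw [this]; exact Submodule.smul_mem _ _ h

theorem exists_weighted_op {ι : Type*} (c : ι → ℂ) (C : ℝ) (hc : ∀ i, ‖c i‖ ≤ C) (σ : ι ≃ ι) :
    ∃ T : lp (fun _ : ι => ℂ) 2 →L[ℂ] lp (fun _ : ι => ℂ) 2,
      ∀ ξ i, T ξ i = c i * ξ (σ i) := by
  have h2 : 0 < (2 : ENNReal).toReal := by norm_num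
  have hs : ∀ ξ : lp (fun _ : ι => ℂ) 2,
      HasSum (fun i => ‖ξ (σ i)‖ ^ (2 : ENNReal).toReal) (‖ξ‖ ^ (2 : ENNReal).toReal) := by
    intro ξ
    exact (σ.hasSum_iff (f := fun i => ‖ξ i‖ ^ (2 : ENNReal).toReal)).2 (lp.hasSum_norm h2 ξ)
  have hle : ∀ (ξ : lp (fun _ : ι => ℂ) 2) i, ‖c i * ξ (σ i)‖ ^ (2 : ENNReal).toReal ≤
      |C| ^ (2 : ENNReal).toReal * ‖ξ (σ i)‖ ^ (2 : ENNReal).toReal := by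
    intro ξ i
    rw [← Real.mul_rpow (abs_nonneg _) (norm_nonneg _), norm_mul]
    gcongr
    exact (hc i).trans (le_abs_self C)
  have hsum : ∀ ξ : lp (fun _ : ι => ℂ) 2,
      Summable fun i => ‖c i * ξ (σ i)‖ ^ (2 : ENNReal).toReal := fun ξ =>
    Summable.of_nonneg_of_le (fun i => by positivity) (hle ξ) ((hs ξ).summable.mul_left _)
  let T : lp (fun _ : ι => ℂ) 2 →ₗ[ℂ] lp (fun _ : ι => ℂ) 2 :=
    { toFun := fun ξ => ⟨fun i => c i * ξ (σ i), memℓp_gen (hsum ξ)⟩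
      map_add' := fun ξ η => by
        ext i
        change c i * (ξ (σ i) + η (σ i)) = c i * ξ (σ i) + c i * η (σ i)
        exact mul_add _ _ _
      map_smul' := fun a ξ => by
        ext i
        simp [mul_left_comm] }
  refine ⟨T.mkContinuous |C| fun ξ => ?_, fun ξ i => rfl⟩
  refine lp.norm_le_of_tsum_le h2 (by positivity) ?_
  rw [Real.mul_rpow (abs_nonneg _) (norm_nonneg _), ← ((hs ξ).mul_left _).tsum_eq]
  exact (hsum ξ).tsum_le_tsum (hle ξ) ((hs ξ).summable.mul_left _)

theorem exists_regRep [T2Space X] [CompactSpace X] {f : Germ ρ → ℂ} (hf : f ∈ Cc ρ) :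
    ∃ T : L2 ρ →L[ℂ] L2 ρ, ∀ ξ γ, T ξ γ = conv f ξ γ := by
  induction hf using Cc_induction with
  | bis g φ =>
    obtain ⟨T, hT⟩ := exists_weighted_op (fun γ : Germ ρ => φ (ρ g⁻¹ (rng γ))) ‖φ‖
      (fun γ => φ.norm_coe_le_norm _) (translate ρ g⁻¹)
    exact ⟨T, fun ξ γ => by rw [hT, conv_bisectionFun]⟩
  | add f g hf hg h1 h2 =>
    obtain ⟨T, hT⟩ := h1
    obtain ⟨S, hS⟩ := h2
    exact ⟨T + S, fun ξ γ => by simp [conv_add_left hf hg, hT, hS]⟩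
  | smul c f hf h =>
    obtain ⟨T, hT⟩ := h
    exact ⟨c • T, fun ξ γ => by simp [conv_smul_left, hT]⟩

variable (ρ) in
/-- The regular representation `π(f) ξ = f * ξ` of `C_c(G)` on `ℓ²(G)`. It is the direct sum over
`x ∈ X` of the representations `π_x` of `C_c(G)` on `ℓ²(G_x)`, so that `‖π(f)‖ = sup_x ‖π_x(f)‖`
is the reduced norm of `f`. -/
def regRep [T2Space X] [CompactSpace X] : Cc ρ →ₗ[ℂ] (L2 ρ →L[ℂ] L2 ρ) where
  toFun f := (exists_regRep f.2).choose
  map_add' f g := by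
    ext ξ γ
    have h1 := (exists_regRep f.2).choose_spec ξ γ
    have h2 := (exists_regRep g.2).choose_spec ξ γ
    have h3 := (exists_regRep (f + g).2).choose_spec ξ γ
    rw [h3, Submodule.coe_add, conv_add_left f.2 g.2, Pi.add_apply, ← h1, ← h2]
    rfl
  map_smul' c f := by
    ext ξ γ
    have h1 := (exists_regRep f.2).choose_spec ξ γ
    have h3 := (exists_regRep (c • f).2).choose_spec ξ γ
    rw [h3, Submodule.coe_smul, conv_smul_left, Pi.smul_apply, ← h1]
    rfl

theorem regRep_apply [T2Space X] [CompactSpace X] (f : Cc ρ) (ξ : L2 ρ) (γ : Germ ρ) :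
    regRep ρ f ξ γ = conv f.1 ξ γ :=
  (exists_regRep f.2).choose_spec ξ γ

theorem regRep_mul [T2Space X] [CompactSpace X] (f g : Cc ρ) :
    regRep ρ f * regRep ρ g = regRep ρ ⟨conv f.1 g.1, conv_mem f.2 g.2⟩ := by
  ext ξ γ
  have h : (regRep ρ g ξ : Germ ρ → ℂ) = conv g.1 ξ := funext fun γ => regRep_apply g ξ γ
  rw [regRep_apply, conv_assoc f.2 g.2, ← h, ← regRep_apply]
  rfl

theorem regRep_star_aux [T2Space X] [CompactSpace X] {f : Germ ρ → ℂ} (hf : f ∈ Cc ρ) :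
    star (regRep ρ ⟨f, hf⟩) = regRep ρ ⟨adj f, adj_mem hf⟩ := by
  induction hf using Cc_induction with
  | bis g φ =>
    rw [ContinuousLinearMap.star_eq_adjoint]
    symm
    rw [ContinuousLinearMap.eq_adjoint_iff]
    intro ξ η
    rw [lp.inner_eq_tsum, lp.inner_eq_tsum]
    conv_rhs => rw [← (translate ρ g).tsum_eq]
    refine tsum_congr fun γ => ?_
    rw [regRep_apply, regRep_apply]
    dsimp only
    simp only [adj_bisectionFun, conv_bisectionFun, rng_translate, map_inv_apply_self, inv_inv]
    have e : translate ρ g⁻¹ (translate ρ g γ) = γ := by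
      induction γ using Germ.ind with | h h x => simp
    rw [e]
    simp only [RCLike.inner_apply, map_mul]
    simp
    ring
  | add f g hf hg h1 h2 =>
    have e1 : (⟨f + g, add_mem hf hg⟩ : Cc ρ) = ⟨f, hf⟩ + ⟨g, hg⟩ := rfl
    have e2 : (⟨adj (f + g), adj_mem (add_mem hf hg)⟩ : Cc ρ) =
        ⟨adj f, adj_mem hf⟩ + ⟨adj g, adj_mem hg⟩ := by
      ext; simp [adj]
    rw [e2, e1, map_add, map_add, star_add, h1, h2]
  | smul c f hf h =>
    have e1 : (⟨c • f, Submodule.smul_mem _ c hf⟩ : Cc ρ) = c • ⟨f, hf⟩ := rfl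
    have e2 : (⟨adj (c • f), adj_mem (Submodule.smul_mem _ c hf)⟩ : Cc ρ) =
        star c • ⟨adj f, adj_mem hf⟩ := by
      ext; simp [adj]
    rw [e2, e1, map_smul, map_smul, star_smul, h]

theorem regRep_star [T2Space X] [CompactSpace X] (f : Cc ρ) :
    star (regRep ρ f) = regRep ρ ⟨adj f.1, adj_mem f.2⟩ := regRep_star_aux f.2

variable (ρ) in
/-- The image of `C_c(G)` under the regular representation. -/
def regRange [T2Space X] [CompactSpace X] : NonUnitalStarSubalgebra ℂ (L2 ρ →L[ℂ] L2 ρ) where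
  carrier := Set.range (regRep ρ)
  add_mem' := by
    rintro _ _ ⟨f, rfl⟩ ⟨g, rfl⟩
    exact ⟨f + g, map_add _ _ _⟩
  zero_mem' := ⟨0, map_zero _⟩
  smul_mem' := by
    rintro c _ ⟨f, rfl⟩
    exact ⟨c • f, map_smul _ _ _⟩
  mul_mem' := by
    rintro _ _ ⟨f, rfl⟩ ⟨g, rfl⟩
    exact ⟨_, (regRep_mul f g).symm⟩
  star_mem' := by
    rintro _ ⟨f, rfl⟩
    exact ⟨_, (regRep_star f).symm⟩

variable (ρ) in
/-- The reduced C*-algebra `C*_r(G)`: the completion of `C_c(G)` for the reduced norm, that is, the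
norm closure of the image of `C_c(G)` under the regular representation. -/
def reducedCStarAlgebra [T2Space X] [CompactSpace X] :
    NonUnitalStarSubalgebra ℂ (L2 ρ →L[ℂ] L2 ρ) :=
  (regRange ρ).topologicalClosure

variable (ρ) in
/-- The copy of `C(X)` in `C*_r(G)`: the operators `π(φ)`, where `φ ∈ C(X)` is regarded as
a function on `G` vanishing off the units. -/
def unitAlgebra [T2Space X] [CompactSpace X] :
    NonUnitalStarSubalgebra ℂ (L2 ρ →L[ℂ] L2 ρ) where
  carrier := Set.range fun φ : C(X, ℂ) => regRep ρ ⟨unitFun ρ φ, unitFun_mem φ⟩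
  add_mem' := by
    rintro _ _ ⟨φ, rfl⟩ ⟨ψ, rfl⟩
    refine ⟨φ + ψ, ?_⟩
    dsimp only
    rw [← map_add]
    congr 1
    ext γ
    simp [unitFun, Set.indicator_add]
  zero_mem' := by
    refine ⟨0, ?_⟩
    dsimp only
    rw [← map_zero (regRep ρ)]
    congr 1
    ext γ
    simp [unitFun]
  smul_mem' := by
    rintro c _ ⟨φ, rfl⟩
    refine ⟨c • φ, ?_⟩
    dsimp only
    rw [← map_smul]
    congr 1
    ext γ
    simp [unitFun, Set.indicator_const_mul]
  mul_mem' := by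
    rintro _ _ ⟨φ, rfl⟩ ⟨ψ, rfl⟩
    refine ⟨φ * ψ, ?_⟩
    dsimp only
    rw [regRep_mul]
    congr 1
    ext γ
    simp only [unitFun_eq, conv_bisectionFun_bisectionFun]
    simp
    rfl
  star_mem' := by
    rintro _ ⟨φ, rfl⟩
    refine ⟨star φ, ?_⟩
    dsimp only
    rw [regRep_star]
    congr 1
    ext γ
    simp only [unitFun_eq, adj_bisectionFun]
    simp
    rfl

/-! ### Maximal abelian subalgebras -/

/-- `C` is an abelian sub-C*-algebra of `A`, where `A` is a norm closed *-algebra of operators. -/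
def IsAbelianSubCStarAlgebra {H : Type*} [NormedAddCommGroup H] [InnerProductSpace ℂ H]
    [CompleteSpace H] (A C : NonUnitalStarSubalgebra ℂ (H →L[ℂ] H)) : Prop :=
  C ≤ A ∧ IsClosed (C : Set (H →L[ℂ] H)) ∧ ∀ S ∈ C, ∀ T ∈ C, S * T = T * S

/-- `C` is a maximal abelian sub-C*-algebra of `A`. -/
def IsMaximalAbelian {H : Type*} [NormedAddCommGroup H] [InnerProductSpace ℂ H]
    [CompleteSpace H] (A C : NonUnitalStarSubalgebra ℂ (H →L[ℂ] H)) : Prop :=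
  Maximal (IsAbelianSubCStarAlgebra A) C

/-! ### Actions of `ℤ²` -/

/-- The action of `ℤ²` in which `(m, n)` acts as `g₁ᵐ g₂ⁿ`, for commuting homeomorphisms. -/
def intSqAction {X : Type*} [TopologicalSpace X] (g₁ g₂ : X ≃ₜ X) (h : Commute g₁ g₂) :
    Multiplicative (ℤ × ℤ) →* (X ≃ₜ X) where
  toFun p := g₁ ^ p.toAdd.1 * g₂ ^ p.toAdd.2
  map_one' := by simp
  map_mul' p q := by
    simp only [toAdd_mul, Prod.fst_add, Prod.snd_add, zpow_add]
    rw [mul_assoc, mul_assoc, ← mul_assoc (g₂ ^ _), ← mul_assoc (g₁ ^ _) (g₂ ^ _),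
      ((h.zpow_zpow _ _).eq)]

end GermGroupoid

end

/-! Each point of the circle is fixed by `g₁` or by `g₂`, and each of them preserves the complement
of its fixed-point set, so they commute. On the open arc that it moves, a homeomorphism displaces
all points in the same direction, so no nonzero power has a fixed point there
(`UnitAddCircle.zpow_apply_ne_self`). Near a point other than `a` and `b` only one generator acts,
and germs forget one exponent. Both open arcs accumulate at `a` and at `b`, so germs there remember
both exponents (`germ_injective`). This determines the isotropy. It also shows that `G` is not
Hausdorff: the germs of `g₁` and of the identity agree along an open arc but differ at its
endpoints.

The loss of one exponent makes the four terms of `f` cancel in pairs away from `a` and `b`, so `f`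
lives on isotropy. A function `φ` on the units multiplies by `φ ∘ rng` from the left and by `φ ∘
src` from the right, and these agree on isotropy: hence `f` commutes with `C(𝕋)`. It takes the value
`-1` at a germ that is not a unit, and the regular representation is faithful on `C_c(G)`
(`regRep_injective`), so its operator is not in the copy of `C(𝕋)`. That operator is normal, as a
combination of commuting operators whose adjoints belong to the same family, and a maximal abelian
subalgebra contains every normal element commuting with it (`IsMaximalAbelian.mem_of_commute`). -/

namespace Homeomorph

/-! ### Powers of a homeomorphism and periodic points -/

variable {X : Type*} [TopologicalSpace X]

theorem zpow_apply_eq_self {g : X ≃ₜ X} {x : X} (h : g x = x) (n : ℤ) : (g ^ n) x = x := by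
  have h' : (g⁻¹ : X ≃ₜ X) x = x := by
    conv_lhs => rw [← h]
    exact g.symm_apply_apply x
  induction n using Int.induction_on with
  | zero => simp
  | succ n ih => rw [zpow_add_one, mul_apply, h, ih]
  | pred n ih => rw [zpow_sub_one, mul_apply, h', ih]

theorem mapsTo_compl_fixedPoints (g : X ≃ₜ X) :
    Set.MapsTo g (Function.fixedPoints g)ᶜ (Function.fixedPoints g)ᶜ :=
  fun _ hx h => hx (g.injective h)

/-- The function `τ` increases strictly along forward orbits in `V`, so these never return. A
negative power fixes a point only if the opposite positive power does. -/
theorem zpow_apply_ne_self_of_lt {g : X ≃ₜ X} {V : Set X} {τ : X → ℝ} (hg : Set.MapsTo g V V)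
    (h : ∀ x ∈ V, τ x < τ (g x)) {x : X} (hx : x ∈ V) {n : ℤ} (hn : n ≠ 0) : (g ^ n) x ≠ x := by
  have key : ∀ k : ℕ, ∀ x ∈ V, τ x < τ ((g ^ (k + 1)) x) := by
    intro k
    induction k with
    | zero => simpa using h
    | succ k ih =>
      intro x hx
      rw [pow_succ, mul_apply]
      exact (h x hx).trans (ih _ (hg hx))
  have key' : ∀ k : ℕ, k ≠ 0 → (g ^ k) x ≠ x := by
    intro k hk e
    obtain ⟨k, rfl⟩ := Nat.exists_eq_succ_of_ne_zero hk
    exact (key k x hx).ne (congrArg τ e.symm)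
  intro e
  refine key' n.natAbs (Int.natAbs_ne_zero.2 hn) ?_
  rw [← zpow_natCast]
  rcases Int.natAbs_eq n with h | h
  · rwa [← h]
  · rw [← neg_eq_iff_eq_neg] at h
    rw [← h, zpow_neg]
    conv_lhs => rw [← e]
    exact (g ^ n).symm_apply_apply x

/-- A homeomorphism without fixed points in an invariant arc has no periodic points there. -/
theorem zpow_apply_ne_self {g : X ≃ₜ X} {V : Set X} {τ : X → ℝ} (hV : IsPreconnected V)
    (hτ : ContinuousOn τ V) (hτ' : Set.InjOn τ V) (hg : Set.MapsTo g V V)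
    (h : ∀ x ∈ V, g x ≠ x) {x : X} (hx : x ∈ V) {n : ℤ} (hn : n ≠ 0) : (g ^ n) x ≠ x := by
  have hne : ∀ y ∈ V, τ (g y) ≠ τ y := fun y hy e => h y hy (hτ' (hg hy) hy e)
  have hc : ContinuousOn (fun y => τ (g y)) V := hτ.comp g.continuous.continuousOn hg
  -- The difference `τ ∘ g - τ` has no zero on the connected set `V`, so its sign is constant; a
  -- negative sign is handled by replacing `τ` with `-τ`.
  by_cases hlt : ∃ y ∈ V, τ y < τ (g y)
  · obtain ⟨y, hy, hlt⟩ := hlt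
    refine zpow_apply_ne_self_of_lt (τ := τ) hg (fun z hz => ?_) hx hn
    by_contra! hle
    obtain ⟨w, hw, e⟩ := hV.intermediate_value₂ hy hz hτ hc hlt.le hle
    exact hne w hw e.symm
  · push Not at hlt
    refine zpow_apply_ne_self_of_lt (τ := fun y => - τ y) hg (fun z hz => ?_) hx hn
    exact neg_lt_neg ((hlt z hz).lt_of_ne (hne z hz))

end Homeomorph

/-! ### Arcs of the circle -/

namespace UnitAddCircle

theorem cIcc_inter_cIcc {a b x : UnitAddCircle} (hab : a ≠ b) (h : x ∈ Set.cIcc a b)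
    (h' : x ∈ Set.cIcc b a) : x = a ∨ x = b := by
  rcases btw_antisymm (Set.mem_cIcc.1 h) (Set.mem_cIcc.1 h') with h | h | h
  · exact Or.inl h.symm
  · exact Or.inr h
  · exact absurd h.symm hab

/-- The complement of an arc is the image of an open interval. -/
theorem exists_compl_cIcc_eq {a b : UnitAddCircle} (hab : a ≠ b) :
    ∃ c d : ℝ, c < d ∧ d < c + 1 ∧ (c : UnitAddCircle) = b ∧ (d : UnitAddCircle) = a ∧
      (Set.cIcc a b)ᶜ = (fun t : ℝ => (t : UnitAddCircle)) '' Set.Ioo c d := by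
  obtain ⟨c, rfl⟩ := QuotientAddGroup.mk_surjective b
  -- Lifting `a` to the fundamental domain that starts at the lift `c` of `b` makes the open arc
  -- from `b` to `a` the image of the interval from `c` to `d`.
  obtain ⟨⟨d, hd⟩, rfl⟩ := (AddCircle.equivIco 1 c).symm.surjective a
  change ((d : ℝ) : UnitAddCircle) ≠ (c : UnitAddCircle) at hab
  have hcd : c < d := hd.1.lt_of_ne fun e => hab (by rw [e])
  refine ⟨c, d, hcd, hd.2, rfl, rfl, ?_⟩
  have hinj : Set.InjOn (fun t : ℝ => (t : UnitAddCircle)) (Set.Ico c (c + 1)) :=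
    fun s hs t ht e => (AddCircle.coe_eq_coe_iff_of_mem_Ico hs ht).1 e
  have hbtw : ∀ t ∈ Set.Ico c (c + 1),
      btw (c : UnitAddCircle) (t : UnitAddCircle) (d : UnitAddCircle) ↔ t ≤ d := by
    intro t ht
    refine (QuotientAddGroup.btw_coe_iff (p := (1 : ℝ))).trans ?_
    rw [(toIcoMod_eq_self _).2 ht, (toIocMod_eq_self _).2 ⟨hcd, hd.2.le⟩]
  have hab' : (c : UnitAddCircle) ≠ (d : UnitAddCircle) := fun e => hab e.symm
  have hc : c ∈ Set.Ico c (c + 1) := ⟨le_rfl, by linarith⟩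
  ext x
  obtain ⟨⟨t, ht⟩, rfl⟩ := (AddCircle.equivIco 1 c).symm.surjective x
  change (t : UnitAddCircle) ∈ (Set.cIcc (d : UnitAddCircle) (c : UnitAddCircle))ᶜ ↔ _
  constructor
  · intro h
    have h2 : t ≤ d := (hbtw t ht).1 ((btw_total (d : UnitAddCircle) t c).resolve_left h)
    refine ⟨t, ⟨ht.1.lt_of_ne ?_, h2.lt_of_ne ?_⟩, rfl⟩
    · rintro rfl; exact h (Set.right_mem_cIcc _ _)
    · rintro rfl; exact h (Set.left_mem_cIcc _ _)
  · rintro ⟨s, hs, e⟩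
    have hs' : s ∈ Set.Ico c (c + 1) := ⟨hs.1.le, hs.2.trans hd.2⟩
    obtain rfl : s = t := hinj hs' ht e
    intro h
    -- A point of this open interval lying in both closed arcs would be an endpoint, contrary to
    -- injectivity on the fundamental domain.
    rcases cIcc_inter_cIcc hab h ((hbtw s ht).2 hs.2.le) with e | e
    · exact hs.2.ne (hinj ht hd e)
    · exact hs.1.ne' (hinj ht hc e)

theorem mem_closure_compl_cIcc {a b x : UnitAddCircle} (hab : a ≠ b) (hx : x = a ∨ x = b) :
    x ∈ closure (Set.cIcc a b)ᶜ := by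
  obtain ⟨c, d, hcd, -, hb, ha, h⟩ := exists_compl_cIcc_eq hab
  rw [h]
  refine image_closure_subset_closure_image (AddCircle.continuous_mk' 1) ?_
  rw [closure_Ioo hcd.ne]
  rcases hx with rfl | rfl
  · exact ⟨d, Set.right_mem_Icc.2 hcd.le, ha⟩
  · exact ⟨c, Set.left_mem_Icc.2 hcd.le, hb⟩

/-- The coordinate of the circle cut open at `b` is injective, and it is continuous on the
complement of the fixed arc because `b` lies in that arc. -/
theorem zpow_apply_ne_self {a b : UnitAddCircle} (hab : a ≠ b) {g : UnitAddCircle ≃ₜ UnitAddCircle}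
    (hg : Function.fixedPoints g = Set.cIcc a b) {x : UnitAddCircle} (hx : x ∉ Set.cIcc a b)
    {n : ℤ} (hn : n ≠ 0) : (g ^ n) x ≠ x := by
  obtain ⟨c, d, -, -, hb, -, h⟩ := exists_compl_cIcc_eq hab
  have hmaps := g.mapsTo_compl_fixedPoints
  rw [hg] at hmaps
  refine Homeomorph.zpow_apply_ne_self (V := (Set.cIcc a b)ᶜ)
    (τ := fun x => (AddCircle.equivIco 1 c x : ℝ)) ?_ ?_ ?_ hmaps ?_ hx hn
  · rw [h]
    exact isPreconnected_Ioo.image _ (AddCircle.continuous_mk' 1).continuousOn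
  · intro y hy
    refine (continuous_subtype_val.continuousAt.comp
      (AddCircle.continuousAt_equivIco 1 c ?_)).continuousWithinAt
    rintro rfl
    exact hy (hb ▸ Set.right_mem_cIcc _ _)
  · exact (Subtype.val_injective.comp (AddCircle.equivIco 1 c).injective).injOn
  · intro y hy e
    exact hy (hg ▸ e)

end UnitAddCircle

/-! ### Germ groupoids: bisections, isotropy and separation -/

namespace GermGroupoid

section General

variable {X Γ : Type*} [TopologicalSpace X] [Group Γ] {ρ : Γ →* (X ≃ₜ X)}

/-- The section `germ ρ g` is a continuous inverse of the source map on `S(g)`, and there the range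
map is the source map followed by `ρ g`. -/
theorem isOpenBisection_bisection (g : Γ) : IsOpenBisection (bisection ρ g) := by
  let e : bisection ρ g ≃ₜ X :=
    { toFun := (bisection ρ g).domRestrict src
      invFun := fun x => ⟨germ ρ g x, mem_bisection.2 rfl⟩
      left_inv := fun γ => Subtype.ext (mem_bisection.1 γ.2).symm
      right_inv := fun _ => rfl
      continuous_toFun := continuous_src.comp continuous_subtype_val
      continuous_invFun := (continuous_germ g).subtype_mk _ }
  refine ⟨isOpen_bisection g, e.isOpenEmbedding, ?_⟩
  have h : (bisection ρ g).domRestrict rng = ρ g ∘ e := by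
    ext γ
    change rng γ.1 = ρ g (src γ.1)
    conv_lhs => rw [mem_bisection.1 γ.2]
    rfl
  rw [h]
  exact (ρ g).isOpenEmbedding.comp e.isOpenEmbedding

/-- The germs at a common fixed point of the action. -/
def isotropyHom {x : X} (hx : ∀ g, ρ g x = x) : Γ →* Isotropy ρ x where
  toFun g := ⟨germ ρ g x, rfl, hx g⟩
  map_one' := rfl
  map_mul' g h := Subtype.ext (comp_germ g h x x (hx h).symm).symm

theorem isotropyHom_surjective {x : X} (hx : ∀ g, ρ g x = x) :
    Function.Surjective (isotropyHom hx) := by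
  rintro ⟨γ, h, h'⟩
  refine ⟨rep γ, Subtype.ext ?_⟩
  subst h
  exact germ_rep γ

theorem subsingleton_isotropy {x : X} (h : ∀ g, ρ g x = x → ∀ᶠ z in 𝓝 x, ρ g z = z) :
    Subsingleton (Isotropy ρ x) := by
  have key : ∀ γ : Isotropy ρ x, γ.1 = unit ρ x := by
    rintro ⟨γ, hs, hr⟩
    induction γ using Germ.ind with | h g y => ?_
    obtain rfl : y = x := hs
    exact germ_eq_iff.2 ⟨rfl, by simpa using h g hr⟩
  exact ⟨fun γ δ => Subtype.ext ((key γ).trans (key δ).symm)⟩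

/-- In a Hausdorff space the set where two continuous sections agree is closed. -/
theorem not_t2Space {g h : Γ} {U : Set X} {x : X} (hx : x ∈ closure U)
    (hU : ∀ y ∈ U, germ ρ g y = germ ρ h y) (hne : germ ρ g x ≠ germ ρ h x) :
    ¬ T2Space (Germ ρ) := by
  intro _
  have hc : IsClosed {y | germ ρ g y = germ ρ h y} :=
    isClosed_eq (continuous_germ g) (continuous_germ h)
  exact hne (closure_minimal hU hc hx)

/-! ### Convolution with functions on the units, and the copy of `C(X)` -/

theorem conv_unitFun_left (φ : X → ℂ) (ξ : Germ ρ → ℂ) (γ : Germ ρ) :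
    conv (unitFun ρ φ) ξ γ = φ (rng γ) * ξ γ := by
  rw [unitFun_eq, conv_bisectionFun]
  induction γ using Germ.ind with | h g x => simp

open Classical in
-- The point masses at the units are the vectors of `ℓ²(G)` from which the operator of `f` gives
-- back the values of `f`.
theorem conv_single_unit (f : Germ ρ → ℂ) (γ : Germ ρ) :
    conv f (lp.single (E := fun _ : Germ ρ => ℂ) 2 (unit ρ (src γ)) 1 : L2 ρ) γ = f γ := by
  have hr : rng (unit ρ (src γ)) = src γ := by simp [unit]
  have hi : inv (unit ρ (src γ)) = unit ρ (src γ) := by simp [unit]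
  unfold conv
  rw [tsum_eq_single ⟨unit ρ (src γ), hr⟩]
  · simp only [hi, lp.single_apply_self, mul_one]
    exact congrArg f (comp_unit γ rfl)
  · rintro ⟨δ, hδ⟩ hne
    rw [lp.single_apply_ne, mul_zero]
    intro e
    have h : δ = unit ρ (src γ) := (inv_inv' δ).symm.trans ((congrArg inv e).trans hi)
    exact hne (Subtype.ext h)

section Compact

variable [T2Space X] [CompactSpace X]

theorem conv_unitFun_right {f : Germ ρ → ℂ} (hf : f ∈ Cc ρ) (φ : X → ℂ) (γ : Germ ρ) :
    conv f (unitFun ρ φ) γ = f γ * φ (src γ) := by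
  induction hf using Cc_induction with
  | bis g ψ =>
    rw [unitFun_eq, conv_bisectionFun_bisectionFun, mul_one]
    by_cases hγ : γ ∈ bisection ρ g
    · simp [bisectionFun, hγ]
    · simp [bisectionFun, hγ]
  | add f g hf hg h1 h2 => rw [conv_add_left hf hg, Pi.add_apply, h1, h2, Pi.add_apply, add_mul]
  | smul c f hf h => simp [conv_smul_left, h, mul_assoc]

/-- The two products multiply `f` by `φ ∘ src` and by `φ ∘ rng`, which coincide on the isotropy. -/
theorem conv_unitFun_comm {f : Germ ρ → ℂ} (hf : f ∈ Cc ρ)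
    (h : ∀ γ, f γ ≠ 0 → src γ = rng γ) (φ : X → ℂ) :
    conv f (unitFun ρ φ) = conv (unitFun ρ φ) f := by
  ext γ
  rw [conv_unitFun_left, conv_unitFun_right hf]
  by_cases hγ : f γ = 0
  · simp [hγ]
  · rw [h γ hγ, mul_comm]

theorem regRep_injective : Function.Injective (regRep ρ) := by
  classical
  intro f g h
  ext γ
  rw [← conv_single_unit f.1, ← conv_single_unit g.1, ← regRep_apply, ← regRep_apply, h]

theorem regRep_mem_reducedCStarAlgebra (f : Cc ρ) : regRep ρ f ∈ reducedCStarAlgebra ρ :=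
  (regRange ρ).le_topologicalClosure ⟨f, rfl⟩

variable (ρ) in
/-- The embedding of `C(X)` in `C*_r(G)`. -/
noncomputable def unitHom : C(X, ℂ) →⋆ₙₐ[ℂ] (L2 ρ →L[ℂ] L2 ρ) where
  toFun φ := regRep ρ ⟨unitFun ρ φ, unitFun_mem φ⟩
  map_smul' c φ := by
    ext ξ γ
    simp [regRep_apply, conv_unitFun_left, mul_assoc]
  map_zero' := by
    ext ξ γ
    simp [regRep_apply, conv_unitFun_left]
  map_add' φ ψ := by
    ext ξ γ
    simp [regRep_apply, conv_unitFun_left, add_mul]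
  map_mul' φ ψ := by
    ext ξ γ
    simp [regRep_apply, conv_unitFun_left, mul_assoc]
  map_star' φ := by
    rw [regRep_star]
    congr 2
    ext γ
    simp only [unitFun_eq, adj_bisectionFun]
    simp
    rfl

theorem unitHom_injective : Function.Injective (unitHom ρ) := by
  intro φ ψ h
  ext x
  have h' := congrFun (Subtype.ext_iff.1 (regRep_injective h)) (unit ρ x)
  simpa only [unitFun_eq, unit, bisectionFun_germ] using h'

theorem isAbelianSubCStarAlgebra_unitAlgebra :
    IsAbelianSubCStarAlgebra (reducedCStarAlgebra ρ) (unitAlgebra ρ) := by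
  refine ⟨?_, ?_, ?_⟩
  · rintro _ ⟨φ, rfl⟩
    exact regRep_mem_reducedCStarAlgebra _
  -- An injective *-homomorphism of C*-algebras is isometric, so its range is closed.
  · exact (NonUnitalStarAlgHom.isometry (unitHom ρ)
      unitHom_injective).isClosedEmbedding.isClosed_range
  · rintro _ ⟨φ, rfl⟩ _ ⟨ψ, rfl⟩
    change unitHom ρ φ * unitHom ρ ψ = unitHom ρ ψ * unitHom ρ φ
    rw [← map_mul, mul_comm, map_mul]

end Compact

end General

/-- A maximal abelian sub-C*-algebra contains the normal elements commuting with it. -/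
theorem IsMaximalAbelian.mem_of_commute {H : Type*} [NormedAddCommGroup H]
    [InnerProductSpace ℂ H] [CompleteSpace H] {A C : NonUnitalStarSubalgebra ℂ (H →L[ℂ] H)}
    (hA : IsClosed (A : Set (H →L[ℂ] H))) (hC : IsMaximalAbelian A C) {T : H →L[ℂ] H}
    (hT : T ∈ A) (hn : IsStarNormal T) (hc : ∀ S ∈ C, T * S = S * T) : T ∈ C := by
  -- The abelian algebra to compare with `C` is the part in `A` of the bicommutant of this set;
  -- normality of `T` makes the set commutative.
  let s : Set (H →L[ℂ] H) := C ∪ {T, star T}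
  have hc' : ∀ S ∈ C, star T * S = S * star T := fun S hS => by
    simpa using (congrArg star (hc (star S) (star_mem hS))).symm
  have hs : ∀ x ∈ s, ∀ y ∈ s, x * y = y * x := by
    have hn' : star T * T = T * star T := hn.star_comm_self
    rintro x (hx | rfl | rfl) y (hy | rfl | rfl)
    · exact hC.1.2.2 x hx y hy
    · exact (hc x hx).symm
    · exact (hc' x hx).symm
    · exact hc y hy
    · rfl
    · exact hn'.symm
    · exact hc' y hy
    · exact hn'
    · rfl
  have hstar : star s = s := by
    ext x
    rw [Set.mem_star]
    change star x ∈ C ∨ star x = T ∨ star x = star T ↔ x ∈ C ∨ x = T ∨ x = star T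
    rw [star_mem_iff, star_inj, star_eq_iff_star_eq, eq_comm (a := star T)]
    tauto
  have hcc : ∀ x ∈ s.centralizer.centralizer, ∀ y ∈ s.centralizer.centralizer, x * y = y * x := by
    -- Taking commutants of `s ⊆ s'` gives `s'' ⊆ s'`, so elements of `s''` commute with each other.
    have hsub : s ⊆ s.centralizer := fun x hx y hy => hs y hy x hx
    intro x hx y hy
    have hxs : x ∈ s.centralizer := Set.centralizer_subset hsub hx
    exact hy x hxs
  let Z : NonUnitalStarSubalgebra ℂ (H →L[ℂ] H) :=
    NonUnitalStarSubalgebra.centralizer ℂ s.centralizer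
  have hZ : (Z : Set (H →L[ℂ] H)) = s.centralizer.centralizer := by
    -- The star-subalgebra centralizer commutes with a set and with its adjoints; nothing is added
    -- since `s'` is self-adjoint.
    have : star s.centralizer = s.centralizer := by rw [Set.star_centralizer, hstar]
    change (s.centralizer ∪ star s.centralizer).centralizer = _
    rw [this, Set.union_self]
  have hle : C ≤ A ⊓ Z := by
    intro S hS
    refine ⟨hC.1.1 hS, ?_⟩
    have : S ∈ (Z : Set (H →L[ℂ] H)) := hZ ▸ Set.subset_centralizer_centralizer (Or.inl hS)
    exact this
  refine hC.2 (y := A ⊓ Z) ⟨inf_le_left, ?_, ?_⟩ hle ⟨hT, ?_⟩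
  · change IsClosed ((A : Set (H →L[ℂ] H)) ∩ Z)
    rw [hZ]
    exact hA.inter (Set.isClosed_centralizer _)
  · intro x hx y hy
    have hx' : x ∈ (Z : Set (H →L[ℂ] H)) := hx.2
    have hy' : y ∈ (Z : Set (H →L[ℂ] H)) := hy.2
    rw [hZ] at hx' hy'
    exact hcc x hx' y hy'
  · have : T ∈ (Z : Set (H →L[ℂ] H)) :=
      hZ ▸ Set.subset_centralizer_centralizer (Or.inr (Or.inl rfl))
    exact this

/-! ### The operators of the bisections -/

section UnitaryOps

variable {X Γ : Type*} [TopologicalSpace X] [T2Space X] [CompactSpace X] [CommGroup Γ]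
  {ρ : Γ →* (X ≃ₜ X)}

variable (ρ) in
/-- The indicator function of the bisection `S(g)` as an element of `C_c(G)`. -/
noncomputable def bisectionOne (g : Γ) : Cc ρ := ⟨bisectionFun ρ g 1, bisectionFun_mem g 1⟩

theorem regRep_bisectionOne_mul (g h : Γ) :
    regRep ρ (bisectionOne ρ g) * regRep ρ (bisectionOne ρ h) =
      regRep ρ (bisectionOne ρ (g * h)) := by
  rw [regRep_mul]
  congr 2
  simp only [bisectionOne, conv_bisectionFun_bisectionFun]
  simp
  rfl

theorem regRep_bisectionOne_star (g : Γ) :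
    star (regRep ρ (bisectionOne ρ g)) = regRep ρ (bisectionOne ρ g⁻¹) := by
  rw [regRep_star]
  congr 2
  simp only [bisectionOne, adj_bisectionFun]
  simp
  rfl

theorem commute_regRep_bisectionOne (g h : Γ) :
    Commute (regRep ρ (bisectionOne ρ g)) (regRep ρ (bisectionOne ρ h)) := by
  rw [Commute, SemiconjBy, regRep_bisectionOne_mul, regRep_bisectionOne_mul, mul_comm]

/-- As `Γ` is commutative, the operators of the bisections commute, and the adjoint of the one at
`g` is the one at `g⁻¹`. -/
theorem isStarNormal_regRep_of_mem_span {f : Cc ρ}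
    (hf : f ∈ Submodule.span ℂ (Set.range (bisectionOne ρ))) : IsStarNormal (regRep ρ f) := by
  have h1 : ∀ g, Commute (regRep ρ f) (regRep ρ (bisectionOne ρ g)) := by
    intro g
    induction hf using Submodule.span_induction with
    | mem f hf =>
      obtain ⟨h, rfl⟩ := hf
      exact commute_regRep_bisectionOne h g
    | zero => rw [map_zero]; exact Commute.zero_left _
    | add f f' _ _ h h' => rw [map_add]; exact h.add_left h'
    | smul c f _ h => rw [map_smul]; exact h.smul_left c
  have h2 : ∀ f' ∈ Submodule.span ℂ (Set.range (bisectionOne ρ)),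
      Commute (star (regRep ρ f')) (regRep ρ f) := by
    intro f' hf'
    induction hf' using Submodule.span_induction with
    | mem f' hf' =>
      obtain ⟨h, rfl⟩ := hf'
      rw [regRep_bisectionOne_star]
      exact (h1 _).symm
    | zero => rw [map_zero, star_zero]; exact Commute.zero_left _
    | add f f' _ _ h h' => rw [map_add, star_add]; exact h.add_left h'
    | smul c f _ h => rw [map_smul, star_smul]; exact h.smul_left _
  exact ⟨h2 f hf⟩

end UnitaryOps

/-! ### The action with two complementary fixed arcs -/

section TwoArcs

variable {a b : UnitAddCircle} {g₁ g₂ : UnitAddCircle ≃ₜ UnitAddCircle}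

/-- The two arcs cover the circle. If one map moves a point, it also moves the image, so the other
map fixes both. -/
theorem commute_of_fixedPoints_eq (h₁ : Function.fixedPoints g₁ = Set.cIcc a b)
    (h₂ : Function.fixedPoints g₂ = Set.cIcc b a) : Commute g₁ g₂ := by
  have key : ∀ {g g' : UnitAddCircle ≃ₜ UnitAddCircle} {x : UnitAddCircle}, g x = x →
      (g' x ≠ x → g (g' x) = g' x) → g (g' x) = g' (g x) := by
    intro g g' x hg hg'
    rw [hg]
    by_cases h : g' x = x
    · rw [h, hg]
    · exact hg' h
  have hcover : ∀ x, g₁ x = x ∨ g₂ x = x := fun x => by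
    rcases btw_total a x b with h | h
    · exact Or.inl (h₁.ge h)
    · exact Or.inr (h₂.ge h)
  ext1 x
  rw [Homeomorph.mul_apply, Homeomorph.mul_apply]
  rcases hcover x with h | h
  · exact key h fun hne => (hcover _).resolve_right (g₂.mapsTo_compl_fixedPoints hne)
  · exact (key h fun hne => (hcover _).resolve_left (g₁.mapsTo_compl_fixedPoints hne)).symm

theorem intSqAction_apply (hc : Commute g₁ g₂) (p : Multiplicative (ℤ × ℤ)) (x : UnitAddCircle) :
    intSqAction g₁ g₂ hc p x = (g₁ ^ p.toAdd.1) ((g₂ ^ p.toAdd.2) x) := rfl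

theorem intSqAction_apply_of_left {hc : Commute g₁ g₂} {x : UnitAddCircle} (hx : g₁ x = x)
    (p : Multiplicative (ℤ × ℤ)) : intSqAction g₁ g₂ hc p x = (g₂ ^ p.toAdd.2) x := by
  rw [intSqAction_apply, ← Homeomorph.mul_apply, (hc.zpow_zpow _ _).eq, Homeomorph.mul_apply,
    Homeomorph.zpow_apply_eq_self hx]

theorem intSqAction_apply_of_right {hc : Commute g₁ g₂} {x : UnitAddCircle} (hx : g₂ x = x)
    (p : Multiplicative (ℤ × ℤ)) : intSqAction g₁ g₂ hc p x = (g₁ ^ p.toAdd.1) x := by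
  rw [intSqAction_apply, Homeomorph.zpow_apply_eq_self hx]

theorem eventually_apply_eq_self (h₁ : Function.fixedPoints g₁ = Set.cIcc a b)
    (h₂ : Function.fixedPoints g₂ = Set.cIcc b a) {x : UnitAddCircle} (hx : x ∉ Set.cIcc b a) :
    ∀ᶠ y in 𝓝 x, g₁ y = y := by
  have : IsClosed (Set.cIcc b a) := h₂ ▸ isClosed_fixedPoints g₂.continuous
  filter_upwards [this.isOpen_compl.mem_nhds hx] with y hy
  exact h₁.ge ((btw_total a y b).resolve_right hy)

theorem germ_eq_germ_of_snd_eq (h₁ : Function.fixedPoints g₁ = Set.cIcc a b)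
    (h₂ : Function.fixedPoints g₂ = Set.cIcc b a) (hc : Commute g₁ g₂) {x : UnitAddCircle}
    (hx : x ∉ Set.cIcc b a) {p q : Multiplicative (ℤ × ℤ)} (h : p.toAdd.2 = q.toAdd.2) :
    germ (intSqAction g₁ g₂ hc) p x = germ (intSqAction g₁ g₂ hc) q x := by
  refine germ_eq_iff.2 ⟨rfl, ?_⟩
  filter_upwards [eventually_apply_eq_self h₁ h₂ hx] with y hy
  rw [intSqAction_apply_of_left hy, intSqAction_apply_of_left hy, h]

theorem germ_eq_germ_of_fst_eq (h₁ : Function.fixedPoints g₁ = Set.cIcc a b)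
    (h₂ : Function.fixedPoints g₂ = Set.cIcc b a) (hc : Commute g₁ g₂) {x : UnitAddCircle}
    (hx : x ∉ Set.cIcc a b) {p q : Multiplicative (ℤ × ℤ)} (h : p.toAdd.1 = q.toAdd.1) :
    germ (intSqAction g₁ g₂ hc) p x = germ (intSqAction g₁ g₂ hc) q x := by
  refine germ_eq_iff.2 ⟨rfl, ?_⟩
  filter_upwards [eventually_apply_eq_self h₂ h₁ hx] with y hy
  rw [intSqAction_apply_of_right hy, intSqAction_apply_of_right hy, h]

/-- An endpoint is a limit of points moved by `g`; at such a point near it `g ^ (m - n)` has a fixed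
point, which forces `m - n = 0`. -/
theorem zpow_inj_of_frequently (hab : a ≠ b) {g : UnitAddCircle ≃ₜ UnitAddCircle}
    (hg : Function.fixedPoints g = Set.cIcc a b) {x : UnitAddCircle} (hx : x = a ∨ x = b)
    {m n : ℤ} (h : ∀ᶠ y in 𝓝 x, y ∉ Set.cIcc a b → (g ^ m) y = (g ^ n) y) : m = n := by
  obtain ⟨y, hy, e⟩ :=
    ((mem_closure_iff_frequently.1 (UnitAddCircle.mem_closure_compl_cIcc hab hx)).and_eventually
      h).exists
  by_contra hmn
  refine UnitAddCircle.zpow_apply_ne_self hab hg hy (sub_ne_zero.2 hmn) ?_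
  rw [sub_eq_neg_add, zpow_add, Homeomorph.mul_apply, e hy, zpow_neg]
  exact (g ^ n).symm_apply_apply y

/-- On the side of the endpoint where `g₂` is the identity the germ determines the exponent of `g₁`,
and on the other side that of `g₂`. -/
theorem germ_injective (hab : a ≠ b) (h₁ : Function.fixedPoints g₁ = Set.cIcc a b)
    (h₂ : Function.fixedPoints g₂ = Set.cIcc b a) (hc : Commute g₁ g₂) {x : UnitAddCircle}
    (hx : x = a ∨ x = b) : Function.Injective fun p => germ (intSqAction g₁ g₂ hc) p x := by
  intro p q h
  have hev := (germ_eq_iff.1 h).2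
  refine Multiplicative.toAdd.injective (Prod.ext ?_ ?_)
  · refine zpow_inj_of_frequently hab h₁ hx ?_
    filter_upwards [hev] with y hy hyI
    have hy2 : g₂ y = y := h₂.ge ((btw_total a y b).resolve_left hyI)
    rwa [intSqAction_apply_of_right hy2, intSqAction_apply_of_right hy2] at hy
  · refine zpow_inj_of_frequently hab.symm h₂ hx.symm ?_
    filter_upwards [hev] with y hy hyI
    have hy1 : g₁ y = y := h₁.ge ((btw_total a y b).resolve_right hyI)
    rwa [intSqAction_apply_of_left hy1, intSqAction_apply_of_left hy1] at hy

theorem intSqAction_apply_endpoint (h₁ : Function.fixedPoints g₁ = Set.cIcc a b)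
    (h₂ : Function.fixedPoints g₂ = Set.cIcc b a) (hc : Commute g₁ g₂) {x : UnitAddCircle}
    (hx : x = a ∨ x = b) (p : Multiplicative (ℤ × ℤ)) : intSqAction g₁ g₂ hc p x = x := by
  have hx1 : g₁ x = x := h₁.ge (by
    rcases hx with rfl | rfl
    exacts [Set.left_mem_cIcc _ _, Set.right_mem_cIcc _ _])
  have hx2 : g₂ x = x := h₂.ge (by
    rcases hx with rfl | rfl
    exacts [Set.right_mem_cIcc _ _, Set.left_mem_cIcc _ _])
  rw [intSqAction_apply_of_left hx1, Homeomorph.zpow_apply_eq_self hx2]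

theorem notMem_cIcc_or (hab : a ≠ b) {x : UnitAddCircle} (hx : ¬ (x = a ∨ x = b)) :
    x ∉ Set.cIcc b a ∨ x ∉ Set.cIcc a b := by
  by_contra! h
  exact hx (UnitAddCircle.cIcc_inter_cIcc hab h.2 h.1)

/-- Near such a point one generator is the identity and the other has no periodic point, so an
element fixing the point has exponent zero in the latter and is locally trivial. -/
theorem subsingleton_isotropy_of_ne (hab : a ≠ b) (h₁ : Function.fixedPoints g₁ = Set.cIcc a b)
    (h₂ : Function.fixedPoints g₂ = Set.cIcc b a) (hc : Commute g₁ g₂) {x : UnitAddCircle}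
    (hx : ¬ (x = a ∨ x = b)) : Subsingleton (Isotropy (intSqAction g₁ g₂ hc) x) := by
  refine subsingleton_isotropy fun p hp => ?_
  rcases notMem_cIcc_or hab hx with h | h
  · have hev := eventually_apply_eq_self h₁ h₂ h
    have hp0 : p.toAdd.2 = 0 := by
      rw [intSqAction_apply_of_left hev.self_of_nhds] at hp
      by_contra hne
      exact UnitAddCircle.zpow_apply_ne_self hab.symm h₂ h hne hp
    filter_upwards [hev] with y hy
    rw [intSqAction_apply_of_left hy, hp0, zpow_zero, Homeomorph.one_apply]
  · have hev := eventually_apply_eq_self h₂ h₁ h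
    have hp0 : p.toAdd.1 = 0 := by
      rw [intSqAction_apply_of_right hev.self_of_nhds] at hp
      by_contra hne
      exact UnitAddCircle.zpow_apply_ne_self hab h₁ h hne hp
    filter_upwards [hev] with y hy
    rw [intSqAction_apply_of_right hy, hp0, zpow_zero, Homeomorph.one_apply]

/-! ### The alternating function -/

open Classical in
theorem bisectionOne_germ {X Γ : Type*} [TopologicalSpace X] [T2Space X] [CompactSpace X]
    [CommGroup Γ] {ρ : Γ →* (X ≃ₜ X)} (p q : Γ) (x : X) :
    (bisectionOne ρ p).1 (germ ρ q x) = if germ ρ q x = germ ρ p x then 1 else 0 := by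
  simp only [bisectionOne, bisectionFun, Set.indicator_apply, mem_bisection, src_germ]
  rfl

/-- The function `1_{S(0,0)} - 1_{S(1,0)} - 1_{S(0,1)} + 1_{S(1,1)}`. -/
noncomputable def alternatingFun (hc : Commute g₁ g₂) : Cc (intSqAction g₁ g₂ hc) :=
  bisectionOne _ (Multiplicative.ofAdd (0, 0)) - bisectionOne _ (Multiplicative.ofAdd (1, 0)) -
    bisectionOne _ (Multiplicative.ofAdd (0, 1)) + bisectionOne _ (Multiplicative.ofAdd (1, 1))

theorem isStarNormal_regRep_alternatingFun (hc : Commute g₁ g₂) :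
    IsStarNormal (regRep _ (alternatingFun hc)) := by
  have h : ∀ p, bisectionOne (intSqAction g₁ g₂ hc) p ∈
      Submodule.span ℂ (Set.range (bisectionOne (intSqAction g₁ g₂ hc))) :=
    fun p => Submodule.subset_span ⟨p, rfl⟩
  exact isStarNormal_regRep_of_mem_span
    (add_mem (sub_mem (sub_mem (h _) (h _)) (h _)) (h _))

open Classical in
theorem alternatingFun_germ (hc : Commute g₁ g₂) (p : Multiplicative (ℤ × ℤ)) (x : UnitAddCircle) :
    letI γ := germ (intSqAction g₁ g₂ hc) p x
    letI δ := fun m n : ℤ => germ (intSqAction g₁ g₂ hc) (Multiplicative.ofAdd (m, n)) x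
    (alternatingFun hc).1 γ = (if γ = δ 0 0 then 1 else 0) - (if γ = δ 1 0 then 1 else 0) -
      (if γ = δ 0 1 then 1 else 0) + (if γ = δ 1 1 then 1 else 0) := by
  simp only [← bisectionOne_germ]
  rfl

theorem alternatingFun_endpoint (hab : a ≠ b) (h₁ : Function.fixedPoints g₁ = Set.cIcc a b)
    (h₂ : Function.fixedPoints g₂ = Set.cIcc b a) (hc : Commute g₁ g₂) {x : UnitAddCircle}
    (hx : x = a ∨ x = b) (m n : ℤ) :
    (alternatingFun hc).1 (germ _ (Multiplicative.ofAdd (m, n)) x) =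
      (if m = 0 ∧ n = 0 then 1 else 0) - (if m = 1 ∧ n = 0 then 1 else 0) -
      (if m = 0 ∧ n = 1 then 1 else 0) + (if m = 1 ∧ n = 1 then 1 else 0) := by
  classical
  have h : ∀ p q, germ (intSqAction g₁ g₂ hc) p x = germ (intSqAction g₁ g₂ hc) q x ↔ p = q :=
    fun p q => (germ_injective hab h₁ h₂ hc hx).eq_iff
  rw [alternatingFun_germ]
  simp only [h, Multiplicative.ofAdd.injective.eq_iff, Prod.mk.injEq]

/-- In either open arc the germs depend on one exponent only, and the terms of `f` that share this
exponent have opposite signs. -/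
theorem alternatingFun_eq_zero (hab : a ≠ b) (h₁ : Function.fixedPoints g₁ = Set.cIcc a b)
    (h₂ : Function.fixedPoints g₂ = Set.cIcc b a) (hc : Commute g₁ g₂) {x : UnitAddCircle}
    (hx : ¬ (x = a ∨ x = b)) (p : Multiplicative (ℤ × ℤ)) :
    (alternatingFun hc).1 (germ _ p x) = 0 := by
  classical
  rw [alternatingFun_germ]
  beta_reduce
  rcases notMem_cIcc_or hab hx with h | h
  · rw [germ_eq_germ_of_snd_eq h₁ h₂ hc h (p := Multiplicative.ofAdd (1, 0))
        (q := Multiplicative.ofAdd (0, 0)) rfl,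
      germ_eq_germ_of_snd_eq h₁ h₂ hc h (p := Multiplicative.ofAdd (1, 1))
        (q := Multiplicative.ofAdd (0, 1)) rfl]
    ring
  · rw [germ_eq_germ_of_fst_eq h₁ h₂ hc h (p := Multiplicative.ofAdd (0, 1))
        (q := Multiplicative.ofAdd (0, 0)) rfl,
      germ_eq_germ_of_fst_eq h₁ h₂ hc h (p := Multiplicative.ofAdd (1, 1))
        (q := Multiplicative.ofAdd (1, 0)) rfl]
    ring

theorem exists_of_alternatingFun_ne_zero (hab : a ≠ b)
    (h₁ : Function.fixedPoints g₁ = Set.cIcc a b) (h₂ : Function.fixedPoints g₂ = Set.cIcc b a)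
    (hc : Commute g₁ g₂) {γ : Germ (intSqAction g₁ g₂ hc)} (hγ : (alternatingFun hc).1 γ ≠ 0) :
    ∃ x, (x = a ∨ x = b) ∧ src γ = x ∧ rng γ = x ∧ ∃ m n : ℤ, (m = 0 ∨ m = 1) ∧
      (n = 0 ∨ n = 1) ∧ γ = germ (intSqAction g₁ g₂ hc) (Multiplicative.ofAdd (m, n)) x := by
  induction γ using Germ.ind with | h p x => ?_
  by_cases hx : x = a ∨ x = b
  · refine ⟨x, hx, rfl, intSqAction_apply_endpoint h₁ h₂ hc hx p, p.toAdd.1, p.toAdd.2, ?_⟩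
    have hp : p = Multiplicative.ofAdd (p.toAdd.1, p.toAdd.2) := rfl
    rw [hp, alternatingFun_endpoint hab h₁ h₂ hc hx] at hγ
    rw [← and_assoc]
    refine ⟨?_, rfl⟩
    by_contra hne
    refine hγ ?_
    rw [if_neg (by tauto), if_neg (by tauto), if_neg (by tauto), if_neg (by tauto)]
    ring
  · exact absurd (alternatingFun_eq_zero hab h₁ h₂ hc hx p) hγ

theorem alternatingFun_ne_unitFun (hab : a ≠ b) (h₁ : Function.fixedPoints g₁ = Set.cIcc a b)
    (h₂ : Function.fixedPoints g₂ = Set.cIcc b a) (hc : Commute g₁ g₂) (φ : UnitAddCircle → ℂ) :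
    (alternatingFun hc).1 ≠ unitFun _ φ := by
  intro e
  -- This germ is not a unit because exponents can be read off at `a`, yet the left side is `-1`
  -- there.
  have h := congrFun e (germ _ (Multiplicative.ofAdd (1, 0)) a)
  rw [alternatingFun_endpoint hab h₁ h₂ hc (Or.inl rfl), unitFun,
    Set.indicator_of_notMem] at h
  · norm_num at h
  · rintro ⟨y, hy⟩
    obtain rfl : y = a := congrArg src hy
    have := germ_injective hab h₁ h₂ hc (Or.inl rfl) hy
    exact absurd (congrArg (fun p => p.toAdd.1) this) (by decide)

end TwoArcs

end GermGroupoid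

/-! ### The theorem -/

theorem mainTheorem1 (a b : UnitAddCircle) (hab : a ≠ b)
    (g₁ g₂ : UnitAddCircle ≃ₜ UnitAddCircle)
    (h₁ : Function.fixedPoints g₁ = Set.cIcc a b)
    (h₂ : Function.fixedPoints g₂ = Set.cIcc b a) :
    ∃ hc : Commute g₁ g₂,
      let ρ := GermGroupoid.intSqAction g₁ g₂ hc
      let germ : ℤ → ℤ → UnitAddCircle → GermGroupoid.Germ ρ :=
        fun m n x => GermGroupoid.germ ρ (Multiplicative.ofAdd (m, n)) x
      let S : ℤ → ℤ → Set (GermGroupoid.Germ ρ) :=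
        fun m n => GermGroupoid.bisection ρ (Multiplicative.ofAdd (m, n))
      let ind : Set (GermGroupoid.Germ ρ) → GermGroupoid.Germ ρ → ℂ :=
        fun A => A.indicator fun _ => 1
      let f : GermGroupoid.Germ ρ → ℂ := ind (S 0 0) - ind (S 1 0) - ind (S 0 1) + ind (S 1 1)
      let A := GermGroupoid.reducedCStarAlgebra ρ
      let B := GermGroupoid.unitAlgebra ρ
      -- the groupoid and its isotropy
      ¬ T2Space (GermGroupoid.Germ ρ) ∧
      (∀ x, Nontrivial (GermGroupoid.Isotropy ρ x) ↔ x = a ∨ x = b) ∧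
      (∀ x, x = a ∨ x = b → ∃ e : Multiplicative (ℤ × ℤ) ≃* GermGroupoid.Isotropy ρ x,
        ∀ m n : ℤ, (e (Multiplicative.ofAdd (m, n))).1 = germ m n x) ∧
      (∀ m n, GermGroupoid.IsOpenBisection (S m n)) ∧
      -- the values of `f`
      (∀ x, x = a ∨ x = b → f (germ 0 0 x) = 1 ∧ f (germ 1 0 x) = -1 ∧ f (germ 0 1 x) = -1 ∧
        f (germ 1 1 x) = 1) ∧
      (∀ γ, f γ ≠ 0 → ∃ x, (x = a ∨ x = b) ∧ GermGroupoid.src γ = x ∧ GermGroupoid.rng γ = x ∧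
        ∃ m n : ℤ, (m = 0 ∨ m = 1) ∧ (n = 0 ∨ n = 1) ∧ γ = germ m n x) ∧
      -- `f` commutes with `C(𝕋)` and does not belong to it
      (∀ φ : C(UnitAddCircle, ℂ),
        GermGroupoid.conv f (GermGroupoid.unitFun ρ φ) =
          GermGroupoid.conv (GermGroupoid.unitFun ρ φ) f) ∧
      (∀ φ : C(UnitAddCircle, ℂ), f ≠ GermGroupoid.unitFun ρ φ) ∧
      (∃ hf : f ∈ GermGroupoid.Cc ρ,
        GermGroupoid.regRep ρ ⟨f, hf⟩ ∈ A ∧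
        (∀ T ∈ B, GermGroupoid.regRep ρ ⟨f, hf⟩ * T = T * GermGroupoid.regRep ρ ⟨f, hf⟩) ∧
        GermGroupoid.regRep ρ ⟨f, hf⟩ ∉ B) ∧
      -- `C(𝕋)` is an abelian sub-C*-algebra of `C*_r(G)` which is not maximal abelian
      GermGroupoid.IsAbelianSubCStarAlgebra A B ∧ ¬ GermGroupoid.IsMaximalAbelian A B := by
  have hc := GermGroupoid.commute_of_fixedPoints_eq h₁ h₂
  refine ⟨hc, ?_⟩
  intro ρ germ S ind f A B
  have hfC : f ∈ GermGroupoid.Cc ρ := (GermGroupoid.alternatingFun hc).2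
  have hsupp : ∀ γ, f γ ≠ 0 → ∃ x, (x = a ∨ x = b) ∧ GermGroupoid.src γ = x ∧
      GermGroupoid.rng γ = x ∧ ∃ m n : ℤ, (m = 0 ∨ m = 1) ∧ (n = 0 ∨ n = 1) ∧ γ = germ m n x :=
    fun γ hγ => GermGroupoid.exists_of_alternatingFun_ne_zero hab h₁ h₂ hc hγ
  have hcomm : ∀ φ : UnitAddCircle → ℂ, GermGroupoid.conv f (GermGroupoid.unitFun ρ φ) =
      GermGroupoid.conv (GermGroupoid.unitFun ρ φ) f :=
    GermGroupoid.conv_unitFun_comm hfC fun γ hγ => by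
      obtain ⟨x, -, hs, hr, -⟩ := hsupp γ hγ
      rw [hs, hr]
  have hne : ∀ φ : UnitAddCircle → ℂ, f ≠ GermGroupoid.unitFun ρ φ :=
    GermGroupoid.alternatingFun_ne_unitFun hab h₁ h₂ hc
  have hcommB : ∀ T ∈ B, GermGroupoid.regRep ρ ⟨f, hfC⟩ * T =
      T * GermGroupoid.regRep ρ ⟨f, hfC⟩ := by
    rintro _ ⟨φ, rfl⟩
    dsimp only
    rw [GermGroupoid.regRep_mul, GermGroupoid.regRep_mul]
    exact congrArg _ (Subtype.ext (hcomm φ))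
  have hnotB : GermGroupoid.regRep ρ ⟨f, hfC⟩ ∉ B := by
    rintro ⟨φ, hφ⟩
    exact hne φ (congrArg Subtype.val (GermGroupoid.regRep_injective hφ)).symm
  have hinj : ∀ x, x = a ∨ x = b → Function.Injective fun p => GermGroupoid.germ ρ p x :=
    fun x hx => GermGroupoid.germ_injective hab h₁ h₂ hc hx
  have hiso : ∀ x, x = a ∨ x = b → ∃ e : Multiplicative (ℤ × ℤ) ≃* GermGroupoid.Isotropy ρ x,
      ∀ m n : ℤ, (e (Multiplicative.ofAdd (m, n))).1 = germ m n x := by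
    intro x hx
    have hfix : ∀ p, ρ p x = x := GermGroupoid.intSqAction_apply_endpoint h₁ h₂ hc hx
    exact ⟨MulEquiv.ofBijective (GermGroupoid.isotropyHom hfix)
      ⟨fun p q h => hinj x hx (congrArg Subtype.val h),
        GermGroupoid.isotropyHom_surjective hfix⟩, fun _ _ => rfl⟩
  refine ⟨?_, fun x => ⟨fun h => ?_, fun hx => ?_⟩, hiso,
    fun m n => GermGroupoid.isOpenBisection_bisection _, fun x hx => ?_, hsupp,
    fun φ => hcomm φ, fun φ => hne φ,
    ⟨hfC, GermGroupoid.regRep_mem_reducedCStarAlgebra _, hcommB, hnotB⟩,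
    GermGroupoid.isAbelianSubCStarAlgebra_unitAlgebra, fun hmax => hnotB ?_⟩
  -- The germs of `g₁` and of the identity agree off the arc from `b` to `a`, whose complement
  -- accumulates at `a`, but they differ at `a`.
  · refine GermGroupoid.not_t2Space (g := Multiplicative.ofAdd (1, 0))
      (h := Multiplicative.ofAdd (0, 0))
      (UnitAddCircle.mem_closure_compl_cIcc hab.symm (Or.inr rfl))
      (fun y hy => GermGroupoid.germ_eq_germ_of_snd_eq h₁ h₂ hc hy rfl)
      ((hinj a (Or.inl rfl)).ne ?_)
    decide
  · by_contra hx
    have := GermGroupoid.subsingleton_isotropy_of_ne hab h₁ h₂ hc hx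
    exact not_nontrivial _ h
  · obtain ⟨e, -⟩ := hiso x hx
    exact e.symm.toEquiv.nontrivial
  · have h := GermGroupoid.alternatingFun_endpoint hab h₁ h₂ hc hx
    refine ⟨(h 0 0).trans ?_, (h 1 0).trans ?_, (h 0 1).trans ?_, (h 1 1).trans ?_⟩ <;> norm_num
  · exact hmax.mem_of_commute (GermGroupoid.regRange ρ).isClosed_topologicalClosure
      (GermGroupoid.regRep_mem_reducedCStarAlgebra _)
      (GermGroupoid.isStarNormal_regRep_alternatingFun hc) hcommB
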